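/- **Setting.** Let $P$ and $Q$ be probability laws on $\mathbb R^m$ (the reference and target inlier laws; in terms of densities $p^*,q^*$), $h:\mathbb R^m\to\mathbb R^d$ and $w:\mathbb R^m\to(0,\infty)$ measurable, $d\ge 2$, and $\Theta\subset\mathbb R^d$ compact and convex. Put $C^*_\theta=\mathbb E_P[w]/\mathbb E_Q[e^{\theta^Th}w]$ and $r_\theta(x)=C^*_\theta e^{\theta^Th(x)}$. Assume there is $\theta^*$ with $\{\theta:\|\theta-\theta^*\|_2\le r_0\}\subset\Theta$ for some $r_0>0$ and $dP=r_{\theta^*}\,dQ$ (that is, $p^*=r_{\theta^*}q^*$). Let $S=\{t:\theta^*_t\ne0\}\neq\emptyset$ and $k=|S|$. The reference data set consists of $n_p^*$ points drawn i.i.d. from $P$ and of further points, the reference outliers, that make up a proportion $\varepsilon_p\in[0,1)$ of it; the target data set consists of $n_q^*$ points drawn i.i.d. from $Q$ and of outliers in proportion $\varepsilon_q\in[0,1)$. The outliers are arbitrary. Let $n^*_{p,q}=\min\{n^*_p,n^*_q\}$ and $\varepsilon=\max\{\varepsilon_p,\varepsilon_q\}$, and let $\hat{\mathbb E}_{p^\dagger},\hat{\mathbb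 E}_{q^\dagger}$ be the empirical means over the two full (contaminated) data sets. For $\lambda>0$ the estimator is $$\hat\theta\in\operatorname*{argmin}_{\theta\in\Theta}\Big\{-\hat{\mathbb E}_{p^\dagger}[\theta^Th\,w]+\hat{\mathbb E}_{p^\dagger}[w]\log\hat{\mathbb E}_{q^\dagger}[e^{\theta^Th}w]+\lambda\|\theta\|_1\Big\}.$$ Let $\nu$ be the maximum of the following six numbers, where $x$ ranges over the reference outliers in $\nu_1,\nu_3$ and over the target outliers in the others, $\theta$ over $\Theta$, $t,t'$ over $\{1,\dots,d\}$ and $s,s'$ over $S$ (a maximum over no outliers is $0$): $\nu_1=\max w$, $\nu_2=\max e^{\theta^Th}w$, $\nu_3=\max w|h_t|$, $\nu_4=\max e^{\theta^Th}w|h_t|$, $\nu_5=\max e^{\theta^Th}w|h_th_{t'}|$, $\nu_6=\max e^{\theta^Th}w|h_th_sh_{s'}|$. Let $$\mathcal I^*(\theta)=\mathbb E_Q[r_\theta w\,hh^T]-\tfrac1{\mathbb E_P[w]}\,\mathbb E_Q[r_\theta w\,h]\,\mathbb E_Q[r_\theta w\,h]^T,\qquad \mathcal I^*=\mathcal I^*(\theta^*).$$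 **Assumptions.** For all $x\in\mathbb R^m$, $\theta\in\Theta$, $t,t'\in\{1,\dots,d\}$, $s,s'\in S$: (1) $0<w(x)\le W_{\max}$ and $\mathbb E_P[w]\ge W_{\min}>0$; (2) $e^{\theta^Th(x)}w(x)\le E_{\max}$ and $\mathbb E_Q[e^{\theta^Th}w]\ge E_{\min}>0$; (3) $|h_t|w$, $|h_t|e^{\theta^Th}w$, $|h_th_{t'}|e^{\theta^Th}w$ and $|h_th_sh_{s'}|e^{\theta^Th}w$ are at most $D_{\max}$ at $x$; (4) $k^{3/2}\varepsilon\nu\le c$; (5) $\Lambda_{\min}[\mathcal I^*_{SS}]\ge\lambda_{\min}>0$; (6) $\|\mathcal I^*_{S^cS}(\mathcal I^*_{SS})^{-1}\|_\infty\le1-\alpha$ with $0<\alpha\le1$, where $\|\cdot\|_\infty$ is the largest absolute row sum; (7) the spectral norm of $\partial_{\theta_t}\mathcal I^*_{SS}(\theta)$ is at most $\lambda_{3,\max}$ for all $\theta$ in the interior of $\Theta$; (8) $n^*_{p,q}\ge C\,k^3\log d$. **Theorem.** There are positive constants $L,M$ depending only on $W_{\max},W_{\min},E_{\max},E_{\min},D_{\max},\alpha$;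 for every $\bar\varepsilon<1$ a positive constant $N$ depending only on these and $\bar\varepsilon$; and for every $\lambda_{\min}>0$, $\lambda_{3,\max}$, $r_0>0$ and $\delta\in(0,1)$ positive constants $C,c$ depending only on all of the foregoing, such that the following holds for every setting as above with $\varepsilon\le\bar\varepsilon$ that satisfies (1)–(8). Let $$\lambda=L(1-\varepsilon_p)\sqrt{\frac{\log(6d/\delta)}{n^*_{p,q}}}+M(1-\varepsilon_p)\sqrt{\frac{\log(2/\delta)}{n^*_p}}+N\varepsilon\nu$$ and suppose that $$\min_{t\in S}|\theta^*_t|\ge\frac{80L}{\lambda_{\min}}\sqrt{\frac{k\log(6d/\delta)}{n^*_{p,q}}}+\frac{80M}{\lambda_{\min}}\sqrt{\frac{k\log(2/\delta)}{n^*_p}}+\frac{80N}{\lambda_{\min}}\frac{\varepsilon\nu\sqrt k}{1-\varepsilon_p}.$$ Then with probability at least $1-8\delta$ the estimator $\hat\theta$ exists and is unique, $\hat\theta_t\ne0$ for $t\in S$, $\hat\theta_t=0$ for $t\notin S$, and $$\|\hat\theta-\theta^*\|_2\le\frac{40L}{\lambda_{\min}}\sqrt{\frac{k\log(6d/\delta)}{n^*_{p,q}}}+\frac{40M}{\lambda_{\min}}\sqrt{\frac{k\log(2/\delta)}{n^*_p}}+\frac{40N}{\lambda_{\min}}\frac{\varepsilon\nu\sqrt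 k}{1-\varepsilon_p}.$$ If the outliers are random, then so is $\nu$, and the claim is that on an event of probability at least $1-8\delta$ the conclusion holds whenever (4) and the lower bound on $\min_{t\in S}|\theta_t^*|$ do. -/

import Mathlib

open MeasureTheory ProbabilityTheory

noncomputable section

namespace WDRE

/-- The data of the density ratio problem: the laws `P` (reference) and `Q` (target) of the inliers
on `ℝ^m`, the feature map `h`, the weight `w`, the parameter set `Θ` and the true parameter `θs`. -/
structure Model (m d : ℕ) where
  P : Measure (EuclideanSpace ℝ (Fin m))
  Q : Measure (EuclideanSpace ℝ (Fin m))
  h : EuclideanSpace ℝ (Fin m) → EuclideanSpace ℝ (Fin d)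
  w : EuclideanSpace ℝ (Fin m) → ℝ
  Θ : Set (EuclideanSpace ℝ (Fin d))
  θs : EuclideanSpace ℝ (Fin d)

/-- Largest absolute row sum, the matrix norm induced by the sup norm of vectors. -/
def rowSumNorm {ι κ : Type*} [Fintype ι] [Fintype κ] (A : Matrix ι κ ℝ) : ℝ :=
  ⨆ i, ∑ j, |A i j|

/-- Smallest eigenvalue of a real symmetric matrix. -/
def minEig {ι : Type*} [Fintype ι] [DecidableEq ι] (A : Matrix ι ι ℝ) : ℝ :=
  sInf (spectrum ℝ A)

/-- Spectral norm (largest singular value) of a square matrix. -/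
def specNorm {ι : Type*} [Fintype ι] [DecidableEq ι] (A : Matrix ι ι ℝ) : ℝ :=
  ‖Matrix.toEuclideanCLM (n := ι) (𝕜 := ℝ) A‖

/-- Empirical mean of `g` over the finite data set `x`. -/
def emp {X ι : Type*} [Fintype ι] (x : ι → X) (g : X → ℝ) : ℝ :=
  (∑ i, g (x i)) / (Fintype.card ι : ℝ)

/-- The proportion of outliers in a data set with `n` inliers and `o` outliers. -/
def contam (n o : ℕ) : ℝ := (o : ℝ) / ((n : ℝ) + (o : ℝ))

/-- The contaminated data set: the inliers `x` together with the outliers `z`. -/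
def merge {X : Type*} {n o : ℕ} (x : Fin n → X) (z : Fin o → X) : Fin n ⊕ Fin o → X :=
  Sum.elim x z

/-- The regularization parameter. Here `npq` is the smaller of the two inlier sample sizes and
`np` is that of the reference sample. -/
def regParam (L M N δ εp ε ν npq np : ℝ) (d : ℕ) : ℝ :=
  L * (1 - εp) * √(Real.log (6 * d / δ) / npq) + M * (1 - εp) * √(Real.log (2 / δ) / np)
    + N * (ε * ν)

/-- The three-term rate, with leading numerical constant `a`. -/
def rate (a L M N lmin δ εp ε ν npq np : ℝ) (k d : ℕ) : ℝ :=
  a * L / lmin * √(k * Real.log (6 * d / δ) / npq) + a * M / lmin * √(k * Real.log (2 / δ) / np)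
    + a * N / lmin * (ε * ν * √k / (1 - εp))

namespace Model

variable {m d : ℕ} (A : Model m d)

/-- `exp(θᵀ h(x)) w(x)`. -/
def tilt (θ : EuclideanSpace ℝ (Fin d)) (x : EuclideanSpace ℝ (Fin m)) : ℝ :=
  Real.exp (inner ℝ θ (A.h x)) * A.w x

/-- The population normalizing term `C*_θ = E_P[w] / E_Q[exp(θᵀ h) w]`. -/
def normConst (θ : EuclideanSpace ℝ (Fin d)) : ℝ :=
  (∫ x, A.w x ∂A.P) / ∫ x, A.tilt θ x ∂A.Q

/-- The normalized density ratio model `r(x; θ, C*_θ) = C*_θ exp(θᵀ h(x))`. -/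
def ratio (θ : EuclideanSpace ℝ (Fin d)) (x : EuclideanSpace ℝ (Fin m)) : ℝ :=
  A.normConst θ * Real.exp (inner ℝ θ (A.h x))

/-- Standing conventions: `P`, `Q` are probability laws, `h` and `w` are measurable, `Θ` is compact
and convex, and `θs` is an interior point of `Θ` such that `P` has density `r(·; θs, C*_θs)` with
respect to `Q` (for laws with densities `p`, `q`: `p = r(·; θs, C*_θs) q`). -/
structure IsValid : Prop where
  prob_P : IsProbabilityMeasure A.P
  prob_Q : IsProbabilityMeasure A.Q
  measurable_h : Measurable A.h
  measurable_w : Measurable A.w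
  isCompact_Θ : IsCompact A.Θ
  convex_Θ : Convex ℝ A.Θ
  mem_interior : A.θs ∈ interior A.Θ
  density : A.P = A.Q.withDensity (fun x => ENNReal.ofReal (A.ratio A.θs x))

/-- The active set `S`. -/
def S : Finset (Fin d) := Finset.univ.filter (fun t => A.θs t ≠ 0)

/-- The number `k = |S|` of non-zero coordinates of `θs`. -/
def k : ℕ := A.S.card

/-- Boundedness of the weight function. -/
def WeightBounded (Wmax Wmin : ℝ) : Prop :=
  (∀ x, 0 < A.w x ∧ A.w x ≤ Wmax) ∧ Wmin ≤ ∫ x, A.w x ∂A.P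

/-- Boundedness of the weighted density ratio. -/
def RatioBounded (Emax Emin : ℝ) : Prop :=
  ∀ θ ∈ A.Θ, (∀ x, A.tilt θ x ≤ Emax) ∧ Emin ≤ ∫ x, A.tilt θ x ∂A.Q

/-- Boundedness of the weighted features. -/
def FeatureBounded (Dmax : ℝ) : Prop :=
  ∀ θ ∈ A.Θ, ∀ x,
    (∀ t, |A.h x t * A.w x| ≤ Dmax) ∧
    (∀ t, |A.h x t * A.tilt θ x| ≤ Dmax) ∧
    (∀ i j, |A.h x i * A.h x j * A.tilt θ x| ≤ Dmax) ∧
    (∀ t, ∀ i ∈ A.S, ∀ j ∈ A.S, |A.h x t * (A.h x i * A.h x j) * A.tilt θ x| ≤ Dmax)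

/-- The weighted Fisher information matrix `I*(θ)`. -/
def fisher (θ : EuclideanSpace ℝ (Fin d)) : Matrix (Fin d) (Fin d) ℝ :=
  Matrix.of fun i j =>
    (∫ x, A.ratio θ x * A.w x * (A.h x i * A.h x j) ∂A.Q)
      - (1 / ∫ x, A.w x ∂A.P)
        * ((∫ x, A.ratio θ x * A.w x * A.h x i ∂A.Q) * ∫ x, A.ratio θ x * A.w x * A.h x j ∂A.Q)

/-- The block `I*_SS(θ)`. -/
def fisherSS (θ : EuclideanSpace ℝ (Fin d)) : Matrix A.S A.S ℝ :=
  (A.fisher θ).submatrix Subtype.val Subtype.val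

/-- The block `I*_{SᶜS}(θ)`. -/
def fisherScS (θ : EuclideanSpace ℝ (Fin d)) : Matrix (A.Sᶜ : Finset (Fin d)) A.S ℝ :=
  (A.fisher θ).submatrix Subtype.val Subtype.val

/-- `∇_t I*_SS(θ)`: the entrywise partial derivative with respect to `θ_t`. -/
def fisherSSDeriv (t : Fin d) (θ : EuclideanSpace ℝ (Fin d)) : Matrix A.S A.S ℝ :=
  Matrix.of fun i j =>
    lineDeriv ℝ (fun η => A.fisherSS η i j) θ (EuclideanSpace.single t (1 : ℝ))

/-- Dependency: the smallest eigenvalue of `I*_SS` is at least `lmin`. -/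
def Dependency (lmin : ℝ) : Prop := lmin ≤ minEig (A.fisherSS A.θs)

/-- Incoherence. -/
def Incoherence (α : ℝ) : Prop :=
  IsUnit (A.fisherSS A.θs) →
    rowSumNorm (A.fisherScS A.θs * (A.fisherSS A.θs)⁻¹) ≤ 1 - α

/-- Smoothness: the spectral norm of `∇_t I*_SS(θ)` is at most `l3max` (the derivatives
exist in the interior of `Θ`). -/
def Smoothness (l3max : ℝ) : Prop :=
  ∀ θ ∈ interior A.Θ, ∀ t, specNorm (A.fisherSSDeriv t θ) ≤ l3max

/-- Largest weight of a reference outlier; here and below a maximum over an empty set of outliers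
is `0`. -/
def ν₁ {op : ℕ} (zp : Fin op → EuclideanSpace ℝ (Fin m)) : ℝ :=
  ⨆ n, A.w (zp n)

/-- Largest weighted density ratio at a target outlier. -/
def ν₂ {oq : ℕ} (zq : Fin oq → EuclideanSpace ℝ (Fin m)) : ℝ :=
  ⨆ n, ⨆ θ : A.Θ, A.tilt θ (zq n)

/-- Largest weighted feature at a reference outlier. -/
def ν₃ {op : ℕ} (zp : Fin op → EuclideanSpace ℝ (Fin m)) : ℝ :=
  ⨆ t, ⨆ n, A.w (zp n) * |A.h (zp n) t|

/-- Largest weighted feature times density ratio at a target outlier. -/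
def ν₄ {oq : ℕ} (zq : Fin oq → EuclideanSpace ℝ (Fin m)) : ℝ :=
  ⨆ t, ⨆ n, ⨆ θ : A.Θ, A.tilt θ (zq n) * |A.h (zq n) t|

/-- Second-order analogue of `ν₄`. -/
def ν₅ {oq : ℕ} (zq : Fin oq → EuclideanSpace ℝ (Fin m)) : ℝ :=
  ⨆ t, ⨆ t', ⨆ n, ⨆ θ : A.Θ, A.tilt θ (zq n) * |A.h (zq n) t * A.h (zq n) t'|

/-- Third-order analogue of `ν₄`, two of the indices in `S`. -/
def ν₆ {oq : ℕ} (zq : Fin oq → EuclideanSpace ℝ (Fin m)) : ℝ :=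
  ⨆ t, ⨆ t' : A.S, ⨆ t'' : A.S, ⨆ n, ⨆ θ : A.Θ,
    A.tilt θ (zq n) * |A.h (zq n) t * A.h (zq n) t' * A.h (zq n) t''|

/-- `ν`, the largest of the six maxima. -/
def ν {op oq : ℕ} (zp : Fin op → EuclideanSpace ℝ (Fin m))
    (zq : Fin oq → EuclideanSpace ℝ (Fin m)) : ℝ :=
  max (A.ν₁ zp) (max (A.ν₂ zq) (max (A.ν₃ zp) (max (A.ν₄ zq) (max (A.ν₅ zq) (A.ν₆ zq)))))

/-- The empirical weighted (unnormalized Kullback-Leibler) loss of the data sets `xp`, `xq`. -/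
def loss {ι κ : Type*} [Fintype ι] [Fintype κ] (xp : ι → EuclideanSpace ℝ (Fin m))
    (xq : κ → EuclideanSpace ℝ (Fin m)) (θ : EuclideanSpace ℝ (Fin d)) : ℝ :=
  -emp xp (fun x => inner ℝ θ (A.h x) * A.w x)
    + emp xp A.w * Real.log (emp xq (A.tilt θ))

/-- `θ` is an L1-penalized estimator: it minimizes `loss + lam * ‖·‖₁` over the
parameter set `Θ`. -/
def IsEstimator {ι κ : Type*} [Fintype ι] [Fintype κ] (lam : ℝ)
    (xp : ι → EuclideanSpace ℝ (Fin m)) (xq : κ → EuclideanSpace ℝ (Fin m))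
    (θ : EuclideanSpace ℝ (Fin d)) : Prop :=
  θ ∈ A.Θ ∧ IsMinOn (fun η => A.loss xp xq η + lam * ∑ t, |η t|) A.Θ θ

end Model

end WDRE

end

/-!
The proof is a primal-dual witness argument around the population Fisher information at the true
parameter `θs`.

*Deterministic part* (`LocalModel.support_recovery`). Suppose the gradient of a convex loss is, near
`θs` and on vectors supported in `S`, linear up to a small slope error, with a matrix that is
elliptic on the block `S` and incoherent. Minimize the penalized loss over the vectors of `Θ`
supported in `S`. Strong monotonicity of the gradient confines every such minimizer to the ball of
radius `40 √k lam / κ` about `θs`, where its signs are those of `θs`; hence the gradient on `S` is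
known exactly, incoherence gives `|G t| < lam` off `S`, and the gradient inequality makes the
restricted minimizer the unique global one.

*Linearization* (`Model.TiltBounded.grad_linearize`). As `exp (θᵀh) w` is bounded uniformly for `θ`
in a ball of radius `r₀` about `θs`, the tilted weight at `θs` decays like `exp (-r₀ ‖h x‖)`. So
`‖h‖ ^ p` times the tilted weight is bounded at every point, by a constant free of the dimension,
and the gradient of the contaminated loss agrees with its linearization at `θs` up to an error of
second order, whatever the outliers are.

*Moments at `θs`*. The gradient and the Hessian at `θs` are functions of moments of order at most
two of the two samples. By Hoeffding's inequality and a union bound over these `O(d²)` moments, the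
inlier means are within `2 B √(log (6 d / δ) / n)` of their expectations on one event that depends
on the inliers only (`Model.exists_concentration_event`). On it, outliers shift a moment by at most
`ε ν`, relative to the proportion of inliers (`abs_emp_merge_sub_le`). The population gradient
vanishes at `θs` and the population Hessian is the Fisher information, so the gradient at `θs` is at
most `α lam / 8` and the Hessian is close to the Fisher information, both after scaling by the
proportion `1 - εp` of reference inliers.

The bounds on the gradient at `θs` involve neither `r₀` nor `lmin`, which is why the constants of
the tuning parameter do not depend on them; the second order errors do, and are absorbed by the
sample size and contamination conditions (`SmallEnough.conditions`).
-/

noncomputable section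

namespace WDRE

open Filter Topology

/-! ### Support recovery for penalized convex losses -/

lemma sum_abs_le_sqrt_card_mul_norm {d : ℕ} (S : Finset (Fin d)) (v : EuclideanSpace ℝ (Fin d)) :
    ∑ t ∈ S, |v t| ≤ √(S.card : ℝ) * ‖v‖ := by
  have h1 : (∑ t ∈ S, |v t|) ^ 2 ≤ S.card * ∑ t ∈ S, |v t| ^ 2 := sq_sum_le_card_mul_sum_sq
  have h2 : ∑ t ∈ S, |v t| ^ 2 ≤ ‖v‖ ^ 2 := by
    rw [EuclideanSpace.norm_sq_eq]
    simp only [Real.norm_eq_abs]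
    exact Finset.sum_le_sum_of_subset_of_nonneg (Finset.subset_univ S) fun _ _ _ => sq_nonneg _
  refine abs_le_of_sq_le_sq' ?_ (by positivity) |>.2
  rw [mul_pow, Real.sq_sqrt (by positivity)]
  exact h1.trans (by gcongr)

lemma abs_coord_le_norm {d : ℕ} (v : EuclideanSpace ℝ (Fin d)) (t : Fin d) : |v t| ≤ ‖v‖ := by
  simpa using PiLp.norm_apply_le v t

/-- The local hypotheses under which the penalized estimator recovers the support of `θs`: `loss`
is convex with (sub)gradient `G`, and near `θs`, on vectors supported in `S`, the gradient is up to
a slope error `ζ` the linear map with matrix `I`, which is `κ`-elliptic on the block `S` and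
satisfies the incoherence condition with margin `α`. -/
structure LocalModel {d : ℕ} (loss : EuclideanSpace ℝ (Fin d) → ℝ)
    (G : EuclideanSpace ℝ (Fin d) → Fin d → ℝ) (θs : EuclideanSpace ℝ (Fin d))
    (S : Finset (Fin d)) (I : Matrix (Fin d) (Fin d) ℝ) (κ α lam ζ ρ : ℝ) : Prop where
  grad_le : ∀ θ θ', loss θ + ∑ t, G θ t * (θ' t - θ t) ≤ loss θ'
  mem_S : ∀ t, t ∈ S ↔ θs t ≠ 0
  nonempty_S : S.Nonempty
  κ_pos : 0 < κ
  α_pos : 0 < α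
  α_le : α ≤ 1
  lam_pos : 0 < lam
  ρ_eq : ρ = 40 * √(S.card : ℝ) * lam / κ
  slope_le : 320 * √(S.card : ℝ) * ζ ≤ α * κ
  curvature : ∀ v : EuclideanSpace ℝ (Fin d), (∀ t ∉ S, v t = 0) →
    κ * ‖v‖ ^ 2 ≤ ∑ t ∈ S, (∑ s, I t s * v s) * v t
  incoherence : ∀ v : EuclideanSpace ℝ (Fin d), (∀ t ∉ S, v t = 0) → ∀ B : ℝ,
    (∀ t ∈ S, |∑ s, I t s * v s| ≤ B) → ∀ t ∉ S, |∑ s, I t s * v s| ≤ (1 - α) * B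
  grad_small : ∀ t, |G θs t| ≤ α * lam / 8
  linearize : ∀ θ₁ θ₂ : EuclideanSpace ℝ (Fin d), ‖θ₁ - θs‖ ≤ ρ → ‖θ₂ - θs‖ ≤ ρ →
    (∀ t ∉ S, θ₁ t = 0) → (∀ t ∉ S, θ₂ t = 0) → ∀ t,
    |G θ₁ t - G θ₂ t - ∑ s, I t s * (θ₁ s - θ₂ s)| ≤ ζ * ‖θ₁ - θ₂‖
  beta_min : ∀ t ∈ S, 2 * ρ ≤ |θs t|

namespace LocalModel

variable {d : ℕ} {loss : EuclideanSpace ℝ (Fin d) → ℝ}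
    {G : EuclideanSpace ℝ (Fin d) → Fin d → ℝ} {θs : EuclideanSpace ℝ (Fin d)}
    {S : Finset (Fin d)} {I : Matrix (Fin d) (Fin d) ℝ} {κ α lam ζ ρ : ℝ}

lemma sqrt_card_pos (H : LocalModel loss G θs S I κ α lam ζ ρ) : 0 < √(S.card : ℝ) :=
  Real.sqrt_pos.2 (by exact_mod_cast H.nonempty_S.card_pos)

lemma ρ_pos (H : LocalModel loss G θs S I κ α lam ζ ρ) : 0 < ρ := by
  have := H.sqrt_card_pos
  have := H.κ_pos
  have := H.lam_pos
  rw [H.ρ_eq]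
  positivity

lemma κ_mul_ρ (H : LocalModel loss G θs S I κ α lam ζ ρ) :
    κ * ρ = 40 * (√(S.card : ℝ) * lam) := by
  rw [H.ρ_eq]
  have := H.κ_pos
  field_simp

lemma supp_θs (H : LocalModel loss G θs S I κ α lam ζ ρ) : ∀ t ∉ S, θs t = 0 := fun t ht => by
  by_contra h
  exact ht ((H.mem_S t).2 h)

lemma ζ_mul_le (H : LocalModel loss G θs S I κ α lam ζ ρ) : ζ * √(S.card : ℝ) ≤ κ / 320 := by
  have h1 := H.slope_le
  have h2 : α * κ ≤ 1 * κ := mul_le_mul_of_nonneg_right H.α_le H.κ_pos.le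
  linarith

/-- The gradient is strongly monotone near `θs` on vectors supported in `S`. -/
lemma strongly_monotone (H : LocalModel loss G θs S I κ α lam ζ ρ)
    {θ₁ θ₂ : EuclideanSpace ℝ (Fin d)}
    (h₁ : ‖θ₁ - θs‖ ≤ ρ) (h₂ : ‖θ₂ - θs‖ ≤ ρ) (s₁ : ∀ t ∉ S, θ₁ t = 0) (s₂ : ∀ t ∉ S, θ₂ t = 0) :
    κ / 2 * ‖θ₁ - θ₂‖ ^ 2 ≤ ∑ t ∈ S, (G θ₁ t - G θ₂ t) * (θ₁ t - θ₂ t) := by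
  have hc := H.curvature (θ₁ - θ₂) fun t ht => by simp [s₁ t ht, s₂ t ht]
  have hl := H.linearize θ₁ θ₂ h₁ h₂ s₁ s₂
  have hs := sum_abs_le_sqrt_card_mul_norm S (θ₁ - θ₂)
  simp only [PiLp.sub_apply] at hc hs
  set D := ‖θ₁ - θ₂‖ with hD
  have hD0 : 0 ≤ D := norm_nonneg _
  have h3 : ∑ t ∈ S, ((∑ s, I t s * (θ₁ s - θ₂ s)) * (θ₁ t - θ₂ t) - ζ * D * |θ₁ t - θ₂ t|)
      ≤ ∑ t ∈ S, (G θ₁ t - G θ₂ t) * (θ₁ t - θ₂ t) := by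
    refine Finset.sum_le_sum fun t _ => ?_
    have h4 := neg_abs_le ((G θ₁ t - G θ₂ t - ∑ s, I t s * (θ₁ s - θ₂ s)) * (θ₁ t - θ₂ t))
    rw [abs_mul] at h4
    have h5 := mul_le_mul_of_nonneg_right (hl t) (abs_nonneg (θ₁ t - θ₂ t))
    linarith
  rw [Finset.sum_sub_distrib, ← Finset.mul_sum] at h3
  have h6 : ζ * D * ∑ t ∈ S, |θ₁ t - θ₂ t| ≤ κ / 320 * D ^ 2 := by
    by_cases hz : 0 ≤ ζ
    · calc _ ≤ ζ * D * (√(S.card : ℝ) * D) := by gcongr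
        _ = (ζ * √(S.card : ℝ)) * D ^ 2 := by ring
        _ ≤ _ := by gcongr; exact H.ζ_mul_le
    · have h7 : ζ * D * ∑ t ∈ S, |θ₁ t - θ₂ t| ≤ 0 := by
        have : 0 ≤ D * ∑ t ∈ S, |θ₁ t - θ₂ t| :=
          mul_nonneg hD0 (Finset.sum_nonneg fun _ _ => abs_nonneg _)
        rw [mul_assoc]
        exact mul_nonpos_of_nonpos_of_nonneg (not_le.1 hz).le this
      have := H.κ_pos
      exact h7.trans (by positivity)
  have := H.κ_pos
  nlinarith [mul_nonneg this.le (sq_nonneg D)]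

lemma sum_abs_split (S : Finset (Fin d)) (θ : EuclideanSpace ℝ (Fin d)) (h : ∀ t ∉ S, θ t = 0) :
    ∑ t, |θ t| = ∑ t ∈ S, |θ t| :=
  (Finset.sum_subset (Finset.subset_univ S) fun t _ ht => by simp [h t ht]).symm

/-- A vector supported in `S` whose penalized loss does not exceed that of `θs` is close to `θs`:
the loss grows at least linearly, with a slope exceeding the penalty, beyond the radius `ρ`. -/
lemma norm_sub_lt (H : LocalModel loss G θs S I κ α lam ζ ρ) {θ : EuclideanSpace ℝ (Fin d)}
    (hs : ∀ t ∉ S, θ t = 0)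
    (hF : loss θ + lam * ∑ t, |θ t| ≤ loss θs + lam * ∑ t, |θs t|) : ‖θ - θs‖ < ρ := by
  by_contra! hcon
  have hρ := H.ρ_pos
  set D := ‖θ - θs‖ with hD
  have hD0 : 0 < D := hρ.trans_le hcon
  -- the point of the segment from `θs` to `θ` at distance `ρ / 2` from `θs`
  set τ : ℝ := ρ / (2 * D) with hτ
  have hτ0 : 0 < τ := by positivity
  have hτD : τ * D = ρ / 2 := by rw [hτ]; field_simp
  have hτ1 : τ ≤ 1 / 2 := by
    rw [hτ, div_le_div_iff₀ (by positivity) (by norm_num)]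
    linarith
  set θ' : EuclideanSpace ℝ (Fin d) := θs + τ • (θ - θs) with hθ'
  have e' : ∀ t, θ' t = θs t + τ * (θ t - θs t) := fun t => by simp [hθ']
  have s' : ∀ t ∉ S, θ' t = 0 := fun t ht => by simp [e', hs t ht, H.supp_θs t ht]
  have hn : ‖θ' - θs‖ = ρ / 2 := by
    rw [hθ', add_sub_cancel_left, norm_smul, Real.norm_of_nonneg hτ0.le, ← hD, hτD]
  have hm := H.strongly_monotone (θ₁ := θ') (θ₂ := θs) (by rw [hn]; linarith)
    (by simp [hρ.le]) s' H.supp_θs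
  rw [hn] at hm
  have g1 := H.grad_le θ' θ
  have g2 := H.grad_le θs θ'
  have r1 : ∀ f : Fin d → ℝ, ∑ t, f t * (θ t - θs t) = ∑ t ∈ S, f t * (θ t - θs t) := fun f =>
    (Finset.sum_subset (Finset.subset_univ S) fun t _ ht => by
      simp [hs t ht, H.supp_θs t ht]).symm
  have e1 : ∑ t, G θ' t * (θ t - θ' t) = (1 - τ) * ∑ t ∈ S, G θ' t * (θ t - θs t) := by
    rw [← r1, Finset.mul_sum]
    refine Finset.sum_congr rfl fun t _ => ?_
    rw [e']; ring
  have e2 : ∑ t, G θs t * (θ' t - θs t) = τ * ∑ t ∈ S, G θs t * (θ t - θs t) := by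
    rw [← r1, Finset.mul_sum]
    refine Finset.sum_congr rfl fun t _ => ?_
    rw [e']; ring
  have e3 : ∑ t ∈ S, (G θ' t - G θs t) * (θ' t - θs t)
      = τ * (∑ t ∈ S, G θ' t * (θ t - θs t) - ∑ t ∈ S, G θs t * (θ t - θs t)) := by
    rw [← Finset.sum_sub_distrib, Finset.mul_sum]
    refine Finset.sum_congr rfl fun t _ => ?_
    rw [e']; ring
  rw [e1] at g1
  rw [e2] at g2
  rw [e3] at hm
  set a := ∑ t ∈ S, G θ' t * (θ t - θs t)
  set b := ∑ t ∈ S, G θs t * (θ t - θs t)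
  have hl1 := sum_abs_le_sqrt_card_mul_norm S (θ - θs)
  simp only [PiLp.sub_apply, ← hD] at hl1
  have hb : -(lam / 8 * ∑ t ∈ S, |θ t - θs t|) ≤ b := by
    rw [Finset.mul_sum, ← Finset.sum_neg_distrib]
    refine Finset.sum_le_sum fun t _ => ?_
    have h4 := neg_abs_le (G θs t * (θ t - θs t))
    rw [abs_mul] at h4
    have h5 : |G θs t| ≤ lam / 8 := (H.grad_small t).trans (by
      have := mul_le_mul_of_nonneg_right H.α_le H.lam_pos.le
      linarith)
    have h6 := mul_le_mul_of_nonneg_right h5 (abs_nonneg (θ t - θs t))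
    linarith
  have hpen : ∑ t, |θs t| - ∑ t, |θ t| ≤ ∑ t ∈ S, |θ t - θs t| := by
    rw [sum_abs_split S θ hs, sum_abs_split S θs H.supp_θs, ← Finset.sum_sub_distrib]
    refine Finset.sum_le_sum fun t _ => ?_
    rw [abs_sub_comm]
    exact abs_sub_abs_le_abs_sub _ _
  set l1 := ∑ t ∈ S, |θ t - θs t|
  have hlam := H.lam_pos
  have hpen' : lam * ∑ t, |θs t| - lam * ∑ t, |θ t| ≤ lam * l1 := by
    rw [← mul_sub]; exact mul_le_mul_of_nonneg_left hpen hlam.le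
  have hl1' : lam * l1 ≤ lam * (√(S.card : ℝ) * D) := mul_le_mul_of_nonneg_left hl1 hlam.le
  -- the monotonicity gain, rescaled to the full segment
  have hgain : κ * ρ * D / 4 ≤ a - b := by
    have h7 : κ / 2 * (ρ / 2) ^ 2 = τ * (κ * ρ * D / 4) := by
      have : τ * (κ * ρ * D / 4) = κ * ρ * (τ * D) / 4 := by ring
      rw [this, hτD]; ring
    rw [h7] at hm
    exact le_of_mul_le_mul_left hm hτ0
  rw [H.κ_mul_ρ] at hgain
  have hq : 0 < √(S.card : ℝ) * lam * D := mul_pos (mul_pos H.sqrt_card_pos hlam) hD0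
  have h8 : (1 / 2) * (a - b) ≤ (1 - τ) * (a - b) :=
    mul_le_mul_of_nonneg_right (by linarith) (by nlinarith)
  nlinarith

/-- The sign of `θs t`. -/
def signVec (θs : EuclideanSpace ℝ (Fin d)) (t : Fin d) : ℝ := if 0 < θs t then 1 else -1

lemma abs_signVec (θs : EuclideanSpace ℝ (Fin d)) (t : Fin d) : |signVec θs t| = 1 := by
  unfold signVec
  split_ifs <;> simp

lemma abs_eq_signVec_mul {θs : EuclideanSpace ℝ (Fin d)} {t : Fin d} {x : ℝ}
    (h : |x - θs t| < |θs t|) : |x| = signVec θs t * x := by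
  unfold signVec
  split_ifs with h0
  · rw [abs_of_pos h0, abs_lt] at h
    rw [abs_of_pos (by linarith), one_mul]
  · rw [abs_of_nonpos (not_lt.1 h0), abs_lt] at h
    rw [abs_of_neg (by linarith), neg_one_mul]

lemma coord_close (H : LocalModel loss G θs S I κ α lam ζ ρ) {θ : EuclideanSpace ℝ (Fin d)}
    (h : ‖θ - θs‖ < ρ) {t : Fin d} (ht : t ∈ S) : |θ t - θs t| < |θs t| := by
  have h1 := abs_coord_le_norm (θ - θs) t
  simp only [PiLp.sub_apply] at h1
  have h2 := H.beta_min t ht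
  have := H.ρ_pos
  linarith

/-- First order condition on the support for a minimizer among the vectors supported in `S`. -/
lemma stationary (H : LocalModel loss G θs S I κ α lam ζ ρ) {Θ : Set (EuclideanSpace ℝ (Fin d))}
    {r : ℝ} (hball : Metric.closedBall θs r ⊆ Θ) (hρr : ρ ≤ r) {θ : EuclideanSpace ℝ (Fin d)}
    (hs : ∀ t ∉ S, θ t = 0) (hnear : ‖θ - θs‖ < ρ)
    (hmin : ∀ η ∈ Θ, (∀ t ∉ S, η t = 0) →
      loss θ + lam * ∑ t, |θ t| ≤ loss η + lam * ∑ t, |η t|) {s : Fin d} (hsS : s ∈ S) :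
    G θ s = -(lam * signVec θs s) := by
  set e : EuclideanSpace ℝ (Fin d) := EuclideanSpace.single s 1 with he
  have hen : ‖e‖ = 1 := by simp [he]
  have hes : ∀ t, t ≠ s → e t = 0 := fun t ht => by simp [he, ht]
  have hess : e s = 1 := by simp [he]
  set gap := ρ - ‖θ - θs‖ with hgap
  have hgap0 : 0 < gap := sub_pos.2 hnear
  set K := |ζ| + |I s s| with hK
  have hK0 : 0 ≤ K := by positivity
  -- the variational inequality along `e` for small steps of either sign
  have key : ∀ x : ℝ, |x| < gap → 0 ≤ x * (G θ s + lam * signVec θs s) + K * x ^ 2 := by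
    intro x hx
    set η := θ + x • e with hη
    have eη : ∀ t, η t = θ t + x * e t := fun t => by simp [hη]
    have hηn : ‖η - θs‖ < ρ := by
      have : η - θs = (θ - θs) + x • e := by rw [hη]; abel
      rw [this]
      refine (norm_add_le _ _).trans_lt ?_
      rw [norm_smul, hen, Real.norm_eq_abs, mul_one]
      linarith
    have hηs : ∀ t ∉ S, η t = 0 := fun t ht => by
      rw [eη, hs t ht, hes t (fun h => ht (h ▸ hsS))]; simp
    have hηΘ : η ∈ Θ := hball (by
      rw [Metric.mem_closedBall, dist_eq_norm]; linarith)
    have h1 := hmin η hηΘ hηs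
    have h2 := H.grad_le η θ
    have h3 := H.linearize η θ hηn.le hnear.le hηs hs s
    have e3 : ∑ u, I s u * (η u - θ u) = I s s * x := by
      rw [Finset.sum_eq_single s]
      · rw [eη, hess]; ring
      · intro b _ hb; rw [eη, hes b hb]; ring
      · simp
    have e2 : ∑ t, G η t * (θ t - η t) = -(G η s * x) := by
      rw [Finset.sum_eq_single s]
      · rw [eη, hess]; ring
      · intro b _ hb; rw [eη, hes b hb]; ring
      · simp
    have e1 : ∑ t, |η t| = ∑ t, |θ t| + signVec θs s * x := by
      have : ∀ t, |η t| = |θ t| + if t = s then signVec θs s * x else 0 := by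
        intro t
        by_cases ht : t = s
        · subst ht
          rw [if_pos rfl, abs_eq_signVec_mul (H.coord_close hηn hsS),
            abs_eq_signVec_mul (H.coord_close hnear hsS), eη, hess]
          ring
        · rw [if_neg ht, eη, hes t ht]; simp
      simp only [this, Finset.sum_add_distrib, Finset.sum_ite_eq', Finset.mem_univ, if_true]
    have e4 : ‖η - θ‖ = |x| := by
      rw [hη, add_sub_cancel_left, norm_smul, hen, Real.norm_eq_abs, mul_one]
    rw [e3, e4] at h3
    rw [e2] at h2
    rw [e1] at h1
    have h5 : (G η s - G θ s) * x ≤ K * x ^ 2 := by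
      have h6 : |G η s - G θ s| ≤ K * |x| := by
        have h7 : G η s - G θ s = (G η s - G θ s - I s s * x) + I s s * x := by ring
        rw [h7]
        refine (abs_add_le _ _).trans ?_
        rw [abs_mul (I s s)]
        have h8 : ζ * |x| ≤ |ζ| * |x| := mul_le_mul_of_nonneg_right (le_abs_self _) (abs_nonneg _)
        rw [hK]; linarith
      calc (G η s - G θ s) * x ≤ |(G η s - G θ s) * x| := le_abs_self _
        _ = |G η s - G θ s| * |x| := abs_mul _ _
        _ ≤ K * |x| * |x| := by gcongr
        _ = K * x ^ 2 := by rw [mul_assoc, ← sq, sq_abs]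
    have h9 : lam * (∑ t, |θ t| + signVec θs s * x)
      = lam * ∑ t, |θ t| + lam * signVec θs s * x := by ring
    rw [h9] at h1
    nlinarith
  set c := G θ s + lam * signVec θs s with hc
  have hc0 : c = 0 := by
    by_contra hne
    have hcpos : 0 < |c| := abs_pos.2 hne
    -- a step against `c`, short enough for the quadratic term to be negligible
    set y := min (gap / (2 * |c|)) (1 / (2 * (K + 1))) with hy
    have hy0 : 0 < y := by positivity
    have hy1 : y * |c| < gap := by
      have : y ≤ gap / (2 * |c|) := min_le_left _ _
      calc y * |c| ≤ gap / (2 * |c|) * |c| := by gcongr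
        _ = gap / 2 := by field_simp
        _ < gap := by linarith
    have hy2 : K * y < 1 := by
      have : y ≤ 1 / (2 * (K + 1)) := min_le_right _ _
      calc K * y ≤ K * (1 / (2 * (K + 1))) := by gcongr
        _ < 1 := by
          rw [mul_one_div, div_lt_one (by positivity)]; linarith
    have h1 := key (-(y * c)) (by rw [abs_neg, abs_mul, abs_of_pos hy0]; exact hy1)
    have h2 : 0 < c ^ 2 := by positivity
    have h3 : -(y * c) * c + K * (-(y * c)) ^ 2 = y * c ^ 2 * (K * y - 1) := by ring
    rw [h3] at h1
    have h4 : y * c ^ 2 * (K * y - 1) < 0 :=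
      mul_neg_of_pos_of_neg (by positivity) (by linarith)
    linarith
  linarith

/-- Strict dual feasibility off the support. -/
lemma abs_grad_lt (H : LocalModel loss G θs S I κ α lam ζ ρ) {θ : EuclideanSpace ℝ (Fin d)}
    (hs : ∀ t ∉ S, θ t = 0) (hnear : ‖θ - θs‖ < ρ)
    (hst : ∀ s ∈ S, G θ s = -(lam * signVec θs s)) {t : Fin d} (ht : t ∉ S) :
    |G θ t| < lam := by
  have hlam := H.lam_pos
  have hα := H.α_pos
  have hl := H.linearize θ θs hnear.le (by simp [H.ρ_pos.le]) hs H.supp_θs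
  have hR : ζ * ‖θ - θs‖ ≤ α * lam / 8 := by
    by_cases hz : 0 ≤ ζ
    · have h1 : ζ * ‖θ - θs‖ ≤ ζ * ρ := mul_le_mul_of_nonneg_left hnear.le hz
      have h2 := H.slope_le
      have h3 : ζ * ρ * κ ≤ α * lam / 8 * κ := by
        calc ζ * ρ * κ = ζ * (κ * ρ) := by ring
          _ = (320 * √(S.card : ℝ) * ζ) * lam / 8 := by rw [H.κ_mul_ρ]; ring
          _ ≤ α * κ * lam / 8 := by gcongr
          _ = _ := by ring
      exact h1.trans (le_of_mul_le_mul_right h3 H.κ_pos)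
    · have h1 : ζ * ‖θ - θs‖ ≤ 0 :=
        mul_nonpos_of_nonpos_of_nonneg (not_le.1 hz).le (norm_nonneg _)
      exact h1.trans (by positivity)
  have hI : ∀ u ∈ S, |∑ s, I u s * (θ - θs) s| ≤ lam + α * lam / 4 := by
    intro u hu
    simp only [PiLp.sub_apply]
    have h1 := hl u
    have h2 := H.grad_small u
    have h3 : |G θ u| = lam := by
      rw [hst u hu, abs_neg, abs_mul, abs_signVec, mul_one, abs_of_pos hlam]
    rw [abs_le] at h1 h2 ⊢
    have h4 := abs_le.1 h3.le
    constructor <;> linarith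
  have h1 := H.incoherence (θ - θs) (fun u hu => by simp [hs u hu, H.supp_θs u hu]) _ hI t ht
  simp only [PiLp.sub_apply] at h1
  have h2 := hl t
  have h3 := H.grad_small t
  have h5 : (1 - α) * (lam + α * lam / 4) < lam - α * lam / 4 := by
    nlinarith [mul_pos hα hlam, mul_pos hα (mul_pos hα hlam)]
  rw [abs_le] at h1 h2 h3
  rw [abs_lt]
  constructor <;> linarith

/-- The primal-dual witness argument: the minimizer among the vectors supported in `S` is the only
minimizer of the penalized loss over `Θ`, and it has full support `S`. -/
theorem support_recovery (H : LocalModel loss G θs S I κ α lam ζ ρ)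
    {Θ : Set (EuclideanSpace ℝ (Fin d))} (hΘ : IsCompact Θ) (hloss : Continuous loss)
    {r : ℝ} (hball : Metric.closedBall θs r ⊆ Θ) (hρr : ρ ≤ r) :
    ∃ θhat : EuclideanSpace ℝ (Fin d),
      (∀ θ, (θ ∈ Θ ∧ IsMinOn (fun η => loss η + lam * ∑ t, |η t|) Θ θ) ↔ θ = θhat) ∧
      (∀ t ∈ S, θhat t ≠ 0) ∧ (∀ t ∉ S, θhat t = 0) ∧ ‖θhat - θs‖ ≤ ρ := by
  have hlam := H.lam_pos
  set F : EuclideanSpace ℝ (Fin d) → ℝ := fun η => loss η + lam * ∑ t, |η t| with hF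
  have hFc : Continuous F := by fun_prop
  have hθsΘ : θs ∈ Θ := hball (Metric.mem_closedBall_self (H.ρ_pos.le.trans hρr))
  have hcl : IsClosed {θ : EuclideanSpace ℝ (Fin d) | ∀ t ∉ S, θ t = 0} := by
    simp only [Set.ofPred_forall]
    exact isClosed_iInter fun t => isClosed_iInter fun _ =>
      isClosed_eq (by fun_prop) continuous_const
  obtain ⟨θh, ⟨hθΘ, hθs⟩, hθmin⟩ := (hΘ.inter_right hcl).exists_isMinOn
    ⟨θs, hθsΘ, H.supp_θs⟩ hFc.continuousOn
  have hmin : ∀ η ∈ Θ, (∀ t ∉ S, η t = 0) → F θh ≤ F η := fun η h1 h2 => hθmin ⟨h1, h2⟩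
  have hnear : ‖θh - θs‖ < ρ := H.norm_sub_lt hθs (hmin θs hθsΘ H.supp_θs)
  have hst : ∀ s ∈ S, G θh s = -(lam * signVec θs s) := fun s hs =>
    H.stationary hball hρr hθs hnear hmin hs
  have hdual : ∀ t ∉ S, |G θh t| < lam := fun t ht => H.abs_grad_lt hθs hnear hst ht
  have hsign : ∀ s ∈ S, |θh s| = signVec θs s * θh s := fun s hs =>
    abs_eq_signVec_mul (H.coord_close hnear hs)
  -- each coordinate contributes nonnegatively to the excess of the penalized loss
  have hterm : ∀ (θ : EuclideanSpace ℝ (Fin d)) t,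
      0 ≤ G θh t * (θ t - θh t) + lam * |θ t| - lam * |θh t| := by
    intro θ t
    by_cases ht : t ∈ S
    · rw [hst t ht, hsign t ht]
      have h1 : signVec θs t * θ t ≤ |θ t| := by
        refine (le_abs_self _).trans ?_
        rw [abs_mul, abs_signVec, one_mul]
      nlinarith
    · rw [hθs t ht]
      have h1 := neg_abs_le (G θh t * θ t)
      rw [abs_mul] at h1
      have h2 := mul_le_mul_of_nonneg_right (hdual t ht).le (abs_nonneg (θ t))
      simp only [abs_zero, sub_zero, mul_zero]
      linarith
  have hexc : ∀ θ : EuclideanSpace ℝ (Fin d),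
      ∑ t, (G θh t * (θ t - θh t) + lam * |θ t| - lam * |θh t|) ≤ F θ - F θh := by
    intro θ
    have h1 := H.grad_le θh θ
    rw [Finset.sum_sub_distrib, Finset.sum_add_distrib, ← Finset.mul_sum, ← Finset.mul_sum]
    simp only [hF]
    linarith
  have hglob : IsMinOn F Θ θh := fun θ _ => by
    have h1 := hexc θ
    have h2 := Finset.sum_nonneg fun t (_ : t ∈ Finset.univ) => hterm θ t
    simp only [Set.mem_ofPred_eq]
    linarith
  refine ⟨θh, fun θ => ⟨fun ⟨hθΘ', hθm⟩ => ?_, ?_⟩, fun t ht h0 => ?_, hθs, hnear.le⟩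
  · have hle : F θ ≤ F θh := hθm hθΘ
    have hs : ∀ t ∉ S, θ t = 0 := by
      intro t ht
      by_contra hne
      have h1 := hexc θ
      have h2 : 0 < ∑ t, (G θh t * (θ t - θh t) + lam * |θ t| - lam * |θh t|) := by
        refine Finset.sum_pos' (fun t _ => hterm θ t) ⟨t, Finset.mem_univ _, ?_⟩
        rw [hθs t ht]
        have h3 := neg_abs_le (G θh t * θ t)
        rw [abs_mul] at h3
        have h4 := mul_lt_mul_of_pos_right (hdual t ht) (abs_pos.2 hne)
        simp only [abs_zero, sub_zero, mul_zero]
        linarith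
      linarith
    have hmin' : ∀ η ∈ Θ, (∀ t ∉ S, η t = 0) → F θ ≤ F η := fun η h1 _ => hθm h1
    have hnear' : ‖θ - θs‖ < ρ := H.norm_sub_lt hs (hmin' θs hθsΘ H.supp_θs)
    have hst' : ∀ s ∈ S, G θ s = -(lam * signVec θs s) := fun s hsS =>
      H.stationary hball hρr hs hnear' hmin' hsS
    have hm := H.strongly_monotone hnear'.le hnear.le hs hθs
    have h0 : ∑ t ∈ S, (G θ t - G θh t) * (θ t - θh t) = 0 :=
      Finset.sum_eq_zero fun t ht => by rw [hst t ht, hst' t ht]; ring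
    rw [h0] at hm
    have h1 : ‖θ - θh‖ ^ 2 ≤ 0 := by
      have := H.κ_pos
      by_contra h
      have h2 : 0 < κ / 2 * ‖θ - θh‖ ^ 2 := mul_pos (by linarith) (not_le.1 h)
      linarith
    have h2 : ‖θ - θh‖ = 0 := by
      have := sq_nonneg ‖θ - θh‖
      exact pow_eq_zero_iff (two_ne_zero) |>.1 (le_antisymm h1 this)
    exact sub_eq_zero.1 (norm_eq_zero.1 h2)
  · rintro rfl
    exact ⟨hθΘ, hglob⟩
  · have := H.coord_close hnear ht
    rw [h0] at this
    simp at this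

end LocalModel

/-! ### The population Fisher information matrix -/

open scoped MatrixOrder in
lemma minEig_mul_le {ι : Type*} [Fintype ι] [DecidableEq ι] {M : Matrix ι ι ℝ}
    (hM : M.IsHermitian) {c : ℝ} (hc : c ≤ minEig M) (v : ι → ℝ) :
    c * ∑ i, v i ^ 2 ≤ ∑ i, (∑ j, M i j * v j) * v i := by
  have h1 : algebraMap ℝ (Matrix ι ι ℝ) c ≤ M := by
    rw [algebraMap_le_iff_le_spectrum (ha := hM)]
    intro x hx
    exact hc.trans (csInf_le (Matrix.finite_real_spectrum).bddBelow hx)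
  have h2 := (Matrix.le_iff.1 h1).dotProduct_mulVec_nonneg v
  rw [Matrix.sub_mulVec, dotProduct_sub] at h2
  have h3 : star v ⬝ᵥ ((algebraMap ℝ (Matrix ι ι ℝ) c).mulVec v) = c * ∑ i, v i ^ 2 := by
    rw [Algebra.algebraMap_eq_smul_one, Matrix.smul_mulVec, Matrix.one_mulVec, dotProduct_smul]
    simp [dotProduct, sq]
  have h4 : star v ⬝ᵥ (M.mulVec v) = ∑ i, (∑ j, M i j * v j) * v i := by
    simp [dotProduct, Matrix.mulVec, mul_comm]
  rw [h3, h4] at h2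
  linarith

lemma isUnit_of_minEig {ι : Type*} [Fintype ι] [DecidableEq ι] {M : Matrix ι ι ℝ}
    {c : ℝ} (hc0 : 0 < c) (hc : c ≤ minEig M) : IsUnit M := by
  by_contra h
  have h0 : (0 : ℝ) ∈ spectrum ℝ M := spectrum.zero_mem_iff ℝ |>.2 h
  have := csInf_le (Matrix.finite_real_spectrum).bddBelow h0
  exact absurd (hc0.trans_le (hc.trans this)) (lt_irrefl _)

lemma abs_mulVec_le_rowSumNorm {ι κ : Type*} [Fintype ι] [Fintype κ] (M : Matrix ι κ ℝ)
    {v : κ → ℝ} {B : ℝ} (hv : ∀ j, |v j| ≤ B) (i : ι) :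
    |∑ j, M i j * v j| ≤ rowSumNorm M * B := by
  have h1 : |∑ j, M i j * v j| ≤ (∑ j, |M i j|) * B := by
    rw [Finset.sum_mul]
    refine (Finset.abs_sum_le_sum_abs _ _).trans (Finset.sum_le_sum fun j _ => ?_)
    rw [abs_mul]
    exact mul_le_mul_of_nonneg_left (hv j) (abs_nonneg _)
  have h2 : ∑ j, |M i j| ≤ rowSumNorm M :=
    le_ciSup (f := fun i => ∑ j, |M i j|) (Set.finite_range _).bddAbove i
  rcases isEmpty_or_nonempty κ with hκ | ⟨⟨j⟩⟩
  · have h3 : rowSumNorm M = 0 := by simp [rowSumNorm]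
    simp [h3]
  · exact h1.trans (mul_le_mul_of_nonneg_right h2 ((abs_nonneg _).trans (hv j)))

namespace Model

variable {m d : ℕ} (A : Model m d)

lemma fisher_symm (θ : EuclideanSpace ℝ (Fin d)) (i j : Fin d) :
    A.fisher θ i j = A.fisher θ j i := by
  simp only [fisher, Matrix.of_apply]
  rw [mul_comm (∫ x, A.ratio θ x * A.w x * A.h x i ∂A.Q)]
  simp only [mul_comm (A.h _ i)]

lemma sum_eq_sum_subtype (f : Fin d → ℝ) (v : EuclideanSpace ℝ (Fin d))
    (hv : ∀ t ∉ A.S, v t = 0) : ∑ s, f s * v s = ∑ s : A.S, f s * v s := by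
  rw [Finset.sum_coe_sort A.S (fun s => f s * v s)]
  exact (Finset.sum_subset (Finset.subset_univ _) fun t _ ht => by simp [hv t ht]).symm

lemma fisher_curvature {lmin : ℝ} (hD : A.Dependency lmin) (v : EuclideanSpace ℝ (Fin d))
    (hv : ∀ t ∉ A.S, v t = 0) :
    lmin * ‖v‖ ^ 2 ≤ ∑ t ∈ A.S, (∑ s, A.fisher A.θs t s * v s) * v t := by
  have hH : (A.fisherSS A.θs).IsHermitian := by
    ext i j
    simp [fisherSS, A.fisher_symm A.θs i.1 j.1]
  have h1 := minEig_mul_le hH hD (fun i : A.S => v i)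
  have h2 : ∑ i : A.S, v i ^ 2 = ‖v‖ ^ 2 := by
    rw [EuclideanSpace.norm_sq_eq, Finset.sum_coe_sort A.S (fun s => v s ^ 2)]
    simp only [Real.norm_eq_abs, sq_abs]
    exact Finset.sum_subset (Finset.subset_univ _) fun t _ ht => by simp [hv t ht]
  rw [h2] at h1
  rw [← Finset.sum_coe_sort A.S (fun t => (∑ s, A.fisher A.θs t s * v s) * v t)]
  simp only [A.sum_eq_sum_subtype _ v hv]
  exact h1

lemma fisher_incoherence {lmin α : ℝ} (hl : 0 < lmin) (hD : A.Dependency lmin)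
    (hI : A.Incoherence α) (v : EuclideanSpace ℝ (Fin d)) (hv : ∀ t ∉ A.S, v t = 0)
    (B : ℝ) (hB : ∀ t ∈ A.S, |∑ s, A.fisher A.θs t s * v s| ≤ B) (t : Fin d) (ht : t ∉ A.S)
    (hne : A.S.Nonempty) :
    |∑ s, A.fisher A.θs t s * v s| ≤ (1 - α) * B := by
  have hU := isUnit_of_minEig hl hD
  have hrow := hI hU
  have hdet : IsUnit (A.fisherSS A.θs).det := (Matrix.isUnit_iff_isUnit_det _).1 hU
  set u : A.S → ℝ := fun i => v i with hu
  set y : A.S → ℝ := (A.fisherSS A.θs).mulVec u with hy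
  have hyB : ∀ i, |y i| ≤ B := fun i => by
    have := hB i i.2
    rw [A.sum_eq_sum_subtype _ v hv] at this
    simpa [hy, Matrix.mulVec, dotProduct, fisherSS, hu] using this
  have h1 := abs_mulVec_le_rowSumNorm (A.fisherScS A.θs * (A.fisherSS A.θs)⁻¹) hyB
    ⟨t, Finset.mem_compl.2 ht⟩
  have h2 : (A.fisherScS A.θs * (A.fisherSS A.θs)⁻¹).mulVec y = (A.fisherScS A.θs).mulVec u := by
    rw [hy, Matrix.mulVec_mulVec, Matrix.mul_assoc, Matrix.nonsing_inv_mul _ hdet, Matrix.mul_one]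
  have h3 := congrFun h2 ⟨t, Finset.mem_compl.2 ht⟩
  simp only [Matrix.mulVec, dotProduct] at h3
  rw [h3] at h1
  rw [A.sum_eq_sum_subtype _ v hv]
  obtain ⟨s, hs⟩ := hne
  have hB0 : 0 ≤ B := (abs_nonneg _).trans (hB s hs)
  exact le_trans h1 (mul_le_mul_of_nonneg_right hrow hB0)

end Model

/-! ### Empirical means -/

section Emp

variable {X ι : Type*} [Fintype ι] (x : ι → X)

lemma emp_add (f g : X → ℝ) : emp x (fun y => f y + g y) = emp x f + emp x g := by
  simp [emp, Finset.sum_add_distrib, add_div]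

lemma emp_sub (f g : X → ℝ) : emp x (fun y => f y - g y) = emp x f - emp x g := by
  simp [emp, Finset.sum_sub_distrib, sub_div]

lemma emp_mul_const (f : X → ℝ) (c : ℝ) : emp x (fun y => f y * c) = emp x f * c := by
  simp [emp, ← Finset.sum_mul, div_mul_eq_mul_div]

lemma emp_sum {κ : Type*} (s : Finset κ) (f : κ → X → ℝ) :
    emp x (fun y => ∑ j ∈ s, f j y) = ∑ j ∈ s, emp x (f j) := by
  simp only [emp]
  rw [Finset.sum_comm, Finset.sum_div]

lemma emp_mono {f g : X → ℝ} (h : ∀ y, f y ≤ g y) : emp x f ≤ emp x g := by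
  unfold emp
  gcongr
  exact h _

lemma emp_nonneg {f : X → ℝ} (h : ∀ y, 0 ≤ f y) : 0 ≤ emp x f :=
  div_nonneg (Finset.sum_nonneg fun _ _ => h _) (Nat.cast_nonneg _)

lemma emp_pos [Nonempty ι] {f : X → ℝ} (h : ∀ y, 0 < f y) : 0 < emp x f :=
  div_pos (Finset.sum_pos (fun _ _ => h _) Finset.univ_nonempty)
    (by exact_mod_cast Fintype.card_pos)

lemma abs_emp_le {f : X → ℝ} {B : ℝ} (hB : 0 ≤ B) (h : ∀ y, |f y| ≤ B) : |emp x f| ≤ B := by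
  unfold emp
  rw [abs_div, Nat.abs_cast]
  refine div_le_of_le_mul₀ (Nat.cast_nonneg _) hB ?_
  refine (Finset.abs_sum_le_sum_abs _ _).trans ?_
  refine (Finset.sum_le_sum fun i _ => h (x i)).trans ?_
  simp [mul_comm]

end Emp

/-! ### Elementary estimates -/

lemma abs_exp_sub_one_le_mul {a M : ℝ} (h : |a| ≤ M) : |Real.exp a - 1| ≤ M * Real.exp M := by
  have hM : 0 ≤ M := (abs_nonneg _).trans h
  have h1 := Real.add_one_le_exp a
  have h2 : Real.exp a - 1 ≤ a * Real.exp a := by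
    have h3 := mul_le_mul_of_nonneg_right (Real.add_one_le_exp (-a)) (Real.exp_pos a).le
    rw [← Real.exp_add, neg_add_cancel, Real.exp_zero] at h3
    linarith
  rw [abs_le] at h
  have h4 : Real.exp a ≤ Real.exp M := Real.exp_le_exp.2 h.2
  have h5 : 1 ≤ Real.exp M := Real.one_le_exp hM
  rw [abs_le]
  constructor
  · nlinarith
  · calc Real.exp a - 1 ≤ a * Real.exp a := h2
      _ ≤ M * Real.exp a := mul_le_mul_of_nonneg_right h.2 (Real.exp_pos a).le
      _ ≤ M * Real.exp M := mul_le_mul_of_nonneg_left h4 hM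

lemma abs_exp_sub_exp_sub_le {a b M : ℝ} (ha : |a| ≤ M) (hb : |b| ≤ M) :
    |Real.exp a - Real.exp b - (a - b)| ≤ |a - b| * (M * Real.exp M) := by
  wlog hab : b ≤ a generalizing a b
  · have h := this hb ha (not_le.1 hab).le
    rw [abs_sub_comm b a] at h
    rw [← abs_neg]
    convert h using 2
    ring
  have h1 := abs_le.1 (abs_exp_sub_one_le_mul ha)
  have h2 := abs_le.1 (abs_exp_sub_one_le_mul hb)
  have key : ∀ p q : ℝ, Real.exp p + (q - p) * Real.exp p ≤ Real.exp q := fun p q => by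
    have h3 := mul_le_mul_of_nonneg_right (Real.add_one_le_exp (q - p)) (Real.exp_pos p).le
    rw [← Real.exp_add, sub_add_cancel] at h3
    linarith
  have h3 := key a b
  have h4 := key b a
  rw [abs_of_nonneg (sub_nonneg.2 hab), abs_le]
  have h0 := sub_nonneg.2 hab
  constructor
  · nlinarith [mul_le_mul_of_nonneg_left h2.1 h0]
  · nlinarith [mul_le_mul_of_nonneg_left h1.2 h0]

lemma pow_le_mul_exp {r y : ℝ} (hr : 0 < r) (hy : 0 ≤ y) {p : ℕ} (hp : p ≤ 3) :
    y ^ p ≤ 6 * (1 + 2 / r) ^ 3 * Real.exp (r / 2 * y) := by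
  have h1 := Real.pow_div_factorial_le_exp (r / 2 * y) (by positivity) p
  rw [div_le_iff₀ (by positivity)] at h1
  have h2 : ((p.factorial : ℕ) : ℝ) ≤ 6 := by
    have : p.factorial ≤ Nat.factorial 3 := Nat.factorial_le hp
    exact_mod_cast this
  have h3 : (2 / r) ^ p ≤ (1 + 2 / r) ^ 3 := by
    have h0 : 0 < 2 / r := by positivity
    calc (2 / r) ^ p ≤ (1 + 2 / r) ^ p := by gcongr; linarith
      _ ≤ _ := pow_le_pow_right₀ (by linarith) hp
  calc y ^ p = (2 / r) ^ p * (r / 2 * y) ^ p := by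
        rw [← mul_pow]; congr 1; field_simp
    _ ≤ (1 + 2 / r) ^ 3 * (Real.exp (r / 2 * y) * 6) := by
        gcongr
        exact h1.trans (by gcongr)
    _ = _ := by ring

lemma abs_div_le_div {x y X c : ℝ} (hx : |x| ≤ X) (hc : 0 < c) (hy : c ≤ y) : |x / y| ≤ X / c := by
  rw [abs_div, abs_of_pos (hc.trans_le hy)]
  exact div_le_div₀ ((abs_nonneg _).trans hx) hx hc hy

/-- The constant of `abs_ratio_linearize`. -/
def ratioConst (K c : ℝ) : ℝ := K / c + 3 * (K ^ 2 / c ^ 2) + 2 * (K ^ 3 / c ^ 3)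

/-- First order expansion of a quotient, with error proportional to the radius `ρ` of the
neighbourhood and to the size `D` of the increment. -/
lemma abs_ratio_linearize {u₀ u₁ u₂ v₀ v₁ v₂ τ β K ρ D c : ℝ} (hc : 0 < c)
    (hu : |u₁ - u₂ - τ| ≤ K * ρ * D) (hv : |v₁ - v₂ - β| ≤ K * ρ * D)
    (hu₂ : |u₂ - u₀| ≤ K * ρ) (hv₁ : |v₁ - v₀| ≤ K * ρ) (hv₂ : |v₂ - v₀| ≤ K * ρ)
    (hτ : |τ| ≤ K * D) (hβ : |β| ≤ K * D) (hu₀ : |u₀| ≤ K) (hu₂' : |u₂| ≤ K)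
    (c₀ : c ≤ v₀) (c₁ : c ≤ v₁) (c₂ : c ≤ v₂) :
    |u₁ / v₁ - u₂ / v₂ - (τ / v₀ - u₀ * β / v₀ ^ 2)| ≤ ratioConst K c * (ρ * D) := by
  have p₀ := hc.trans_le c₀
  have p₁ := hc.trans_le c₁
  have p₂ := hc.trans_le c₂
  have e : u₁ / v₁ - u₂ / v₂ - (τ / v₀ - u₀ * β / v₀ ^ 2)
      = (u₁ - u₂ - τ) / v₁ - τ * (v₁ - v₀) / (v₁ * v₀) - u₂ * (v₁ - v₂ - β) / (v₁ * v₂)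
        - β * (u₂ - u₀) / (v₁ * v₂) + β * u₀ * (v₁ - v₀) / (v₁ * v₂ * v₀)
        + β * u₀ * (v₂ - v₀) / (v₂ * v₀ * v₀) := by
    field_simp
    ring
  have mulb : ∀ {p q P Q : ℝ}, |p| ≤ P → |q| ≤ Q → |p * q| ≤ P * Q := fun {p q P Q} h h' => by
    rw [abs_mul]
    exact mul_le_mul h h' (abs_nonneg _) ((abs_nonneg _).trans h)
  have c2 : ∀ {x y : ℝ}, c ≤ x → c ≤ y → c ^ 2 ≤ x * y := fun hx hy => by
    rw [sq]; exact mul_le_mul hx hy hc.le (hc.le.trans hx)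
  have c3 : ∀ {x y z : ℝ}, c ≤ x → c ≤ y → c ≤ z → c ^ 3 ≤ x * y * z := fun hx hy hz => by
    rw [pow_succ]
    exact mul_le_mul (c2 hx hy) hz hc.le (mul_nonneg (hc.le.trans hx) (hc.le.trans hy))
  have b1 := abs_div_le_div hu hc c₁
  have b2 := abs_div_le_div (mulb hτ hv₁) (pow_pos hc 2) (c2 c₁ c₀)
  have b3 := abs_div_le_div (mulb hu₂' hv) (pow_pos hc 2) (c2 c₁ c₂)
  have b4 := abs_div_le_div (mulb hβ hu₂) (pow_pos hc 2) (c2 c₁ c₂)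
  have b5 := abs_div_le_div (mulb (mulb hβ hu₀) hv₁) (pow_pos hc 3) (c3 c₁ c₂ c₀)
  have b6 := abs_div_le_div (mulb (mulb hβ hu₀) hv₂) (pow_pos hc 3) (c3 c₂ c₀ c₀)
  have fin : ratioConst K c * (ρ * D) = K * ρ * D / c + K * D * (K * ρ) / c ^ 2
      + K * (K * ρ * D) / c ^ 2 + K * D * (K * ρ) / c ^ 2 + K * D * K * (K * ρ) / c ^ 3
      + K * D * K * (K * ρ) / c ^ 3 := by
    unfold ratioConst
    ring
  rw [e, fin]
  rw [abs_le] at *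
  constructor <;> linarith [b1.1, b1.2, b2.1, b2.2, b3.1, b3.2, b4.1, b4.2, b5.1, b5.2,
    b6.1, b6.2]

/-! ### The empirical loss -/

namespace Model

variable {m d : ℕ} (A : Model m d)

lemma tilt_eq (θ θ' : EuclideanSpace ℝ (Fin d)) (x : EuclideanSpace ℝ (Fin m)) :
    A.tilt θ' x = A.tilt θ x * Real.exp (inner ℝ (θ' - θ) (A.h x)) := by
  unfold tilt
  rw [inner_sub_left, mul_right_comm, ← Real.exp_add]
  congr 2
  ring

lemma tilt_pos (hw : ∀ x, 0 < A.w x) (θ : EuclideanSpace ℝ (Fin d))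
    (x : EuclideanSpace ℝ (Fin m)) : 0 < A.tilt θ x :=
  mul_pos (Real.exp_pos _) (hw x)

lemma inner_eq_sum (a b : EuclideanSpace ℝ (Fin d)) : inner ℝ a b = ∑ t, b t * a t := by
  simp [PiLp.inner_apply]

lemma abs_inner_sub_le {θ : EuclideanSpace ℝ (Fin d)} {ρ : ℝ} (h : ‖θ - A.θs‖ ≤ ρ)
    (x : EuclideanSpace ℝ (Fin m)) : |inner ℝ (θ - A.θs) (A.h x)| ≤ ρ * ‖A.h x‖ :=
  (abs_real_inner_le_norm _ _).trans (by gcongr)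

section Loss

variable {ι κ : Type*} [Fintype ι] [Fintype κ] (xp : ι → EuclideanSpace ℝ (Fin m))
    (xq : κ → EuclideanSpace ℝ (Fin m))

/-- The gradient of the empirical loss. -/
def grad (θ : EuclideanSpace ℝ (Fin d)) (t : Fin d) : ℝ :=
  -emp xp (fun x => A.h x t * A.w x)
    + emp xp A.w * (emp xq (fun x => A.h x t * A.tilt θ x) / emp xq (A.tilt θ))

/-- The Hessian of the empirical loss at `θs`. -/
def hess : Matrix (Fin d) (Fin d) ℝ := Matrix.of fun t s =>
  emp xp A.w * (emp xq (fun x => A.h x t * A.h x s * A.tilt A.θs x) / emp xq (A.tilt A.θs)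
    - emp xq (fun x => A.h x t * A.tilt A.θs x) * emp xq (fun x => A.h x s * A.tilt A.θs x)
      / emp xq (A.tilt A.θs) ^ 2)

lemma continuous_loss [Nonempty κ] (hw : ∀ x, 0 < A.w x) : Continuous (A.loss xp xq) := by
  have h1 : Continuous fun θ => emp xq (A.tilt θ) := by unfold emp tilt; fun_prop
  have h2 : Continuous fun θ => Real.log (emp xq (A.tilt θ)) :=
    h1.log fun θ => (emp_pos xq (A.tilt_pos hw θ)).ne'
  have h3 : Continuous fun θ => emp xp (fun x => inner ℝ θ (A.h x) * A.w x) := by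
    unfold emp; fun_prop
  unfold loss
  fun_prop

lemma emp_inner_mul (g : EuclideanSpace ℝ (Fin m) → ℝ) (v : EuclideanSpace ℝ (Fin d)) :
    emp xq (fun x => inner ℝ v (A.h x) * g x) = ∑ t, emp xq (fun x => A.h x t * g x) * v t := by
  simp only [← emp_mul_const, ← emp_sum]
  congr 1
  ext x
  rw [inner_eq_sum, Finset.sum_mul]
  exact Finset.sum_congr rfl fun t _ => by ring

/-- The gradient inequality for the loss, which encodes its convexity. -/
lemma loss_add_grad_le [Nonempty κ] (hw : ∀ x, 0 < A.w x) (θ θ' : EuclideanSpace ℝ (Fin d)) :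
    A.loss xp xq θ + ∑ t, A.grad xp xq θ t * (θ' t - θ t) ≤ A.loss xp xq θ' := by
  have hv : 0 < emp xq (A.tilt θ) := emp_pos xq (A.tilt_pos hw θ)
  have hb : 0 ≤ emp xp A.w := emp_nonneg xp fun x => (hw x).le
  set v := emp xq (A.tilt θ) with hvdef
  have hlin : emp xq (fun x => inner ℝ (θ' - θ) (A.h x) * A.tilt θ x)
      = ∑ t, emp xq (fun x => A.h x t * A.tilt θ x) * (θ' t - θ t) := by
    simp [A.emp_inner_mul xq]
  set β := (∑ t, emp xq (fun x => A.h x t * A.tilt θ x) * (θ' t - θ t)) / v with hβ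
  -- Jensen's inequality for the exponential, at the tilted mean `β`
  have hJ : v * Real.exp β ≤ emp xq (A.tilt θ') := by
    have h1 : ∀ x, (A.tilt θ x * (1 - β) + inner ℝ (θ' - θ) (A.h x) * A.tilt θ x) * Real.exp β
        ≤ A.tilt θ' x := by
      intro x
      rw [A.tilt_eq θ θ']
      have h2 := Real.add_one_le_exp (inner ℝ (θ' - θ) (A.h x) - β)
      have h3 := mul_le_mul_of_nonneg_right h2 (Real.exp_pos β).le
      rw [← Real.exp_add, sub_add_cancel] at h3
      have h4 := mul_le_mul_of_nonneg_left h3 (A.tilt_pos hw θ x).le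
      linarith
    have h2 := emp_mono xq h1
    rw [emp_mul_const, emp_add, emp_mul_const, hlin] at h2
    have h3 : ∑ t, emp xq (fun x => A.h x t * A.tilt θ x) * (θ' t - θ t) = β * v := by
      rw [hβ]; field_simp
    rw [h3, ← hvdef] at h2
    linarith
  have hlog : Real.log v + β ≤ Real.log (emp xq (A.tilt θ')) := by
    have h1 := Real.log_le_log (by positivity) hJ
    rwa [Real.log_mul hv.ne' (Real.exp_pos β).ne', Real.log_exp] at h1
  have h5 := mul_le_mul_of_nonneg_left hlog hb
  have h6 : ∑ t, A.grad xp xq θ t * (θ' t - θ t)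
      = -(∑ t, emp xp (fun x => A.h x t * A.w x) * θ' t
          - ∑ t, emp xp (fun x => A.h x t * A.w x) * θ t) + emp xp A.w * β := by
    rw [hβ, Finset.sum_div, Finset.mul_sum, ← Finset.sum_sub_distrib, ← Finset.sum_neg_distrib,
      ← Finset.sum_add_distrib]
    refine Finset.sum_congr rfl fun t _ => ?_
    unfold grad
    ring
  unfold loss
  rw [h6, A.emp_inner_mul xp, A.emp_inner_mul xp]
  linarith

end Loss

/-! ### Linearization of the gradient

Since the tilted weights are bounded by `Emax` on a ball of radius `r₀` about `θs`, at `θs` they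
decay like `exp (-r₀ ‖h x‖)`. All moments needed below are therefore bounded pointwise, at inliers
and outliers alike, independently of the dimension. -/

/-- A bound for `‖h‖ ^ p` times the tilted weight, `p ≤ 3`, near `θs`. -/
def momentConst (r₀ E : ℝ) : ℝ := E * (6 * (1 + 2 / r₀) ^ 3)

/-- The tilted weights are positive, and at most `E` on the ball of radius `r₀` about `θs`. -/
structure TiltBounded (r₀ E : ℝ) : Prop where
  r_pos : 0 < r₀
  w_pos : ∀ x, 0 < A.w x
  tilt_le : ∀ θ ∈ Metric.closedBall A.θs r₀, ∀ x, A.tilt θ x ≤ E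

namespace TiltBounded

variable {A} {r₀ E : ℝ}

lemma tilt_mul_exp_le (T : A.TiltBounded r₀ E) (x : EuclideanSpace ℝ (Fin m)) :
    A.tilt A.θs x * Real.exp (r₀ * ‖A.h x‖) ≤ E := by
  set θ := A.θs + (r₀ / ‖A.h x‖) • A.h x with hθ
  have h1 : θ ∈ Metric.closedBall A.θs r₀ := by
    rw [Metric.mem_closedBall, dist_eq_norm, hθ, add_sub_cancel_left, norm_smul, norm_div,
      norm_norm, Real.norm_of_nonneg T.r_pos.le]
    rcases eq_or_ne ‖A.h x‖ 0 with h0 | h0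
    · simp [h0, T.r_pos.le]
    · rw [div_mul_cancel₀ _ h0]
  have h2 : inner ℝ (θ - A.θs) (A.h x) = r₀ * ‖A.h x‖ := by
    rw [hθ, add_sub_cancel_left, inner_smul_left, real_inner_self_eq_norm_sq]
    -- also correct when `h x = 0`, where the quotient is `0`
    rcases eq_or_ne ‖A.h x‖ 0 with h0 | h0
    · simp [h0]
    · simp only [conj_trivial]
      field_simp
  have h3 := T.tilt_le θ h1 x
  rwa [A.tilt_eq A.θs θ, h2] at h3

lemma E_pos (T : A.TiltBounded r₀ E) (x : EuclideanSpace ℝ (Fin m)) : 0 < E :=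
  (mul_pos (A.tilt_pos T.w_pos A.θs x) (Real.exp_pos _)).trans_le (T.tilt_mul_exp_le x)

lemma momentConst_pos (T : A.TiltBounded r₀ E) (x : EuclideanSpace ℝ (Fin m)) :
    0 < momentConst r₀ E := by
  have h1 := T.E_pos x
  have h2 := T.r_pos
  unfold momentConst
  positivity

lemma moment_le (T : A.TiltBounded r₀ E) {ρ : ℝ} (hρ : ρ ≤ r₀ / 2) (x : EuclideanSpace ℝ (Fin m))
    {p : ℕ} (hp : p ≤ 3) :
    A.tilt A.θs x * Real.exp (ρ * ‖A.h x‖) * ‖A.h x‖ ^ p ≤ momentConst r₀ E := by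
  have hr := T.r_pos
  have ht := A.tilt_pos T.w_pos A.θs x
  calc A.tilt A.θs x * Real.exp (ρ * ‖A.h x‖) * ‖A.h x‖ ^ p
      ≤ A.tilt A.θs x * Real.exp (r₀ / 2 * ‖A.h x‖)
        * (6 * (1 + 2 / r₀) ^ 3 * Real.exp (r₀ / 2 * ‖A.h x‖)) := by
        gcongr
        exact pow_le_mul_exp hr (norm_nonneg _) hp
    _ = (A.tilt A.θs x * (Real.exp (r₀ / 2 * ‖A.h x‖) * Real.exp (r₀ / 2 * ‖A.h x‖)))
        * (6 * (1 + 2 / r₀) ^ 3) := by ring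
    _ = (A.tilt A.θs x * Real.exp (r₀ * ‖A.h x‖)) * (6 * (1 + 2 / r₀) ^ 3) := by
        rw [← Real.exp_add, ← add_mul, add_halves]
    _ ≤ E * (6 * (1 + 2 / r₀) ^ 3) := by
        gcongr
        exact T.tilt_mul_exp_le x

lemma tilt_mul_pow_le (T : A.TiltBounded r₀ E) {θ : EuclideanSpace ℝ (Fin d)} {ρ : ℝ}
    (h : ‖θ - A.θs‖ ≤ ρ) (hρ : ρ ≤ r₀ / 2) (x : EuclideanSpace ℝ (Fin m)) {p : ℕ} (hp : p ≤ 3) :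
    A.tilt θ x * ‖A.h x‖ ^ p ≤ momentConst r₀ E := by
  refine le_trans ?_ (T.moment_le hρ x hp)
  rw [A.tilt_eq A.θs θ]
  have ht := A.tilt_pos T.w_pos A.θs x
  gcongr
  exact (abs_le.1 (A.abs_inner_sub_le h x)).2

lemma abs_tilt_sub_mul_le (T : A.TiltBounded r₀ E) {θ : EuclideanSpace ℝ (Fin d)} {ρ : ℝ}
    (h : ‖θ - A.θs‖ ≤ ρ) (hρ : ρ ≤ r₀ / 2) (x : EuclideanSpace ℝ (Fin m)) {p : ℕ} (hp : p ≤ 1) :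
    |A.tilt θ x - A.tilt A.θs x| * ‖A.h x‖ ^ p ≤ momentConst r₀ E * ρ := by
  have ht := A.tilt_pos T.w_pos A.θs x
  have hρ0 : 0 ≤ ρ := (norm_nonneg _).trans h
  have h1 := abs_exp_sub_one_le_mul (A.abs_inner_sub_le h x)
  have h2 : A.tilt θ x - A.tilt A.θs x
      = A.tilt A.θs x * (Real.exp (inner ℝ (θ - A.θs) (A.h x)) - 1) := by
    rw [A.tilt_eq A.θs θ]; ring
  rw [h2, abs_mul, abs_of_pos ht]
  calc _ ≤ A.tilt A.θs x * (ρ * ‖A.h x‖ * Real.exp (ρ * ‖A.h x‖)) * ‖A.h x‖ ^ p := by gcongr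
    _ = (A.tilt A.θs x * Real.exp (ρ * ‖A.h x‖) * ‖A.h x‖ ^ (p + 1)) * ρ := by ring
    _ ≤ _ := by gcongr; exact T.moment_le hρ x (by omega)

lemma abs_tilt_linearize_mul_le (T : A.TiltBounded r₀ E) {θ₁ θ₂ : EuclideanSpace ℝ (Fin d)} {ρ : ℝ}
    (h₁ : ‖θ₁ - A.θs‖ ≤ ρ) (h₂ : ‖θ₂ - A.θs‖ ≤ ρ) (hρ : ρ ≤ r₀ / 2)
    (x : EuclideanSpace ℝ (Fin m)) {p : ℕ} (hp : p ≤ 1) :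
    |A.tilt θ₁ x - A.tilt θ₂ x - inner ℝ (θ₁ - θ₂) (A.h x) * A.tilt A.θs x| * ‖A.h x‖ ^ p
      ≤ momentConst r₀ E * ρ * ‖θ₁ - θ₂‖ := by
  have ht := A.tilt_pos T.w_pos A.θs x
  have hρ0 : 0 ≤ ρ := (norm_nonneg _).trans h₁
  have h1 := abs_exp_sub_exp_sub_le (A.abs_inner_sub_le h₁ x) (A.abs_inner_sub_le h₂ x)
  rw [← inner_sub_left, sub_sub_sub_cancel_right] at h1
  have h2 : A.tilt θ₁ x - A.tilt θ₂ x - inner ℝ (θ₁ - θ₂) (A.h x) * A.tilt A.θs x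
      = A.tilt A.θs x * (Real.exp (inner ℝ (θ₁ - A.θs) (A.h x))
        - Real.exp (inner ℝ (θ₂ - A.θs) (A.h x)) - inner ℝ (θ₁ - θ₂) (A.h x)) := by
    rw [A.tilt_eq A.θs θ₁, A.tilt_eq A.θs θ₂]; ring
  have h3 := abs_real_inner_le_norm (θ₁ - θ₂) (A.h x)
  rw [h2, abs_mul, abs_of_pos ht]
  calc _ ≤ A.tilt A.θs x * (‖θ₁ - θ₂‖ * ‖A.h x‖ * (ρ * ‖A.h x‖ * Real.exp (ρ * ‖A.h x‖)))
        * ‖A.h x‖ ^ p := by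
        gcongr
        exact h1.trans (by gcongr)
    _ = (A.tilt A.θs x * Real.exp (ρ * ‖A.h x‖) * ‖A.h x‖ ^ (p + 2)) * ρ * ‖θ₁ - θ₂‖ := by ring
    _ ≤ _ := by gcongr; exact T.moment_le hρ x (by omega)

/-- Near `θs` the gradient of the empirical loss is, up to a slope error proportional to the
radius, the linear map given by the Hessian at `θs`. -/
lemma grad_linearize (T : A.TiltBounded r₀ E) {ι κ : Type*} [Fintype ι] [Fintype κ]
    (xp : ι → EuclideanSpace ℝ (Fin m)) (xq : κ → EuclideanSpace ℝ (Fin m))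
    {θ₁ θ₂ : EuclideanSpace ℝ (Fin d)} {ρ c W : ℝ}
    (h₁ : ‖θ₁ - A.θs‖ ≤ ρ) (h₂ : ‖θ₂ - A.θs‖ ≤ ρ) (hρ : ρ ≤ r₀ / 2) (hc : 0 < c)
    (hc' : 2 * c ≤ emp xq (A.tilt A.θs)) (hρc : momentConst r₀ E * ρ ≤ c)
    (hW : ∀ x, A.w x ≤ W) (t : Fin d) :
    |A.grad xp xq θ₁ t - A.grad xp xq θ₂ t - ∑ s, A.hess xp xq t s * (θ₁ s - θ₂ s)|
      ≤ W * ratioConst (momentConst r₀ E) c * (ρ * ‖θ₁ - θ₂‖) := by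
  have hρ0 : 0 ≤ ρ := (norm_nonneg _).trans h₁
  have hr := T.r_pos
  have hs0 : ‖A.θs - A.θs‖ ≤ ρ := by simpa using hρ0
  set K := momentConst r₀ E with hKdef
  have hK : 0 ≤ K := (T.momentConst_pos 0).le
  set D := ‖θ₁ - θ₂‖ with hDdef
  have hD : 0 ≤ D := norm_nonneg _
  have ht1 : ∀ x, |A.h x t| ≤ ‖A.h x‖ := fun x => abs_coord_le_norm _ _
  have hpos := fun x => A.tilt_pos T.w_pos A.θs x
  set τ := ∑ s, emp xq (fun x => A.h x t * A.h x s * A.tilt A.θs x) * (θ₁ s - θ₂ s) with hτ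
  set β := ∑ s, emp xq (fun x => A.h x s * A.tilt A.θs x) * (θ₁ s - θ₂ s) with hβ
  have hτ' : τ = emp xq (fun x => A.h x t * (inner ℝ (θ₁ - θ₂) (A.h x) * A.tilt A.θs x)) := by
    have h := A.emp_inner_mul xq (fun x => A.h x t * A.tilt A.θs x) (θ₁ - θ₂)
    simp only [PiLp.sub_apply] at h
    rw [hτ]
    convert h.symm using 2
    · congr 2
      ext x; ring
    · ext x; ring
  have hβ' : β = emp xq (fun x => inner ℝ (θ₁ - θ₂) (A.h x) * A.tilt A.θs x) := by
    simp [A.emp_inner_mul xq, hβ]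
  have hlin : ∀ x, |inner ℝ (θ₁ - θ₂) (A.h x) * A.tilt A.θs x| ≤ D * (A.tilt A.θs x * ‖A.h x‖) := by
    intro x
    rw [abs_mul, abs_of_pos (hpos x)]
    have := abs_real_inner_le_norm (θ₁ - θ₂) (A.h x)
    have h0 := hpos x
    calc _ ≤ ‖θ₁ - θ₂‖ * ‖A.h x‖ * A.tilt A.θs x := by gcongr
      _ = _ := by ring
  have bτ : |τ| ≤ K * D := by
    rw [hτ']
    refine abs_emp_le xq (by positivity) fun x => ?_
    rw [abs_mul]
    calc _ ≤ ‖A.h x‖ * (D * (A.tilt A.θs x * ‖A.h x‖)) :=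
          mul_le_mul (ht1 x) (hlin x) (abs_nonneg _) (norm_nonneg _)
      _ = (A.tilt A.θs x * ‖A.h x‖ ^ 2) * D := by ring
      _ ≤ K * D := by gcongr; exact T.tilt_mul_pow_le hs0 hρ x (by norm_num)
  have bβ : |β| ≤ K * D := by
    rw [hβ']
    refine abs_emp_le xq (by positivity) fun x => (hlin x).trans ?_
    calc _ = (A.tilt A.θs x * ‖A.h x‖ ^ 1) * D := by ring
      _ ≤ K * D := by gcongr; exact T.tilt_mul_pow_le hs0 hρ x (by norm_num)
  have bu : |emp xq (fun x => A.h x t * A.tilt θ₁ x) - emp xq (fun x => A.h x t * A.tilt θ₂ x) - τ|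
      ≤ K * ρ * D := by
    rw [hτ', ← emp_sub, ← emp_sub]
    refine abs_emp_le xq (by positivity) fun x => ?_
    rw [← mul_sub, ← mul_sub, abs_mul, mul_comm]
    refine le_trans ?_ (T.abs_tilt_linearize_mul_le h₁ h₂ hρ x le_rfl)
    rw [pow_one]
    gcongr
    exact ht1 x
  have bv : |emp xq (A.tilt θ₁) - emp xq (A.tilt θ₂) - β| ≤ K * ρ * D := by
    rw [hβ', ← emp_sub, ← emp_sub]
    refine abs_emp_le xq (by positivity) fun x => ?_
    simpa using T.abs_tilt_linearize_mul_le h₁ h₂ hρ x (Nat.zero_le 1)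
  have bu2 : |emp xq (fun x => A.h x t * A.tilt θ₂ x) - emp xq (fun x => A.h x t * A.tilt A.θs x)|
      ≤ K * ρ := by
    rw [← emp_sub]
    refine abs_emp_le xq (by positivity) fun x => ?_
    rw [← mul_sub, abs_mul, mul_comm]
    refine le_trans ?_ (T.abs_tilt_sub_mul_le h₂ hρ x le_rfl)
    rw [pow_one]
    gcongr
    exact ht1 x
  have bvi : ∀ θ : EuclideanSpace ℝ (Fin d), ‖θ - A.θs‖ ≤ ρ →
      |emp xq (A.tilt θ) - emp xq (A.tilt A.θs)| ≤ K * ρ := fun θ hθ => by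
    rw [← emp_sub]
    refine abs_emp_le xq (by positivity) fun x => ?_
    simpa using T.abs_tilt_sub_mul_le hθ hρ x (Nat.zero_le 1)
  have bui : ∀ θ : EuclideanSpace ℝ (Fin d), ‖θ - A.θs‖ ≤ ρ →
      |emp xq (fun x => A.h x t * A.tilt θ x)| ≤ K := fun θ hθ => by
    refine abs_emp_le xq hK fun x => ?_
    have h0 := A.tilt_pos T.w_pos θ x
    rw [abs_mul, abs_of_pos h0, mul_comm]
    refine le_trans ?_ (T.tilt_mul_pow_le hθ hρ x (p := 1) (by norm_num))
    rw [pow_one]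
    gcongr
    exact ht1 x
  have cvi : ∀ θ : EuclideanSpace ℝ (Fin d), ‖θ - A.θs‖ ≤ ρ → c ≤ emp xq (A.tilt θ) :=
    fun θ hθ => by
      have := (abs_le.1 (bvi θ hθ)).1
      linarith
  have main := abs_ratio_linearize hc bu bv bu2 (bvi _ h₁) (bvi _ h₂) bτ bβ
    (bui _ hs0) (bui _ h₂) (cvi _ hs0) (cvi _ h₁) (cvi _ h₂)
  have hb0 : 0 ≤ emp xp A.w := emp_nonneg xp fun x => (T.w_pos x).le
  have hW0 : 0 ≤ W := (T.w_pos 0).le.trans (hW 0)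
  have hbW : emp xp A.w ≤ W := (le_abs_self _).trans (abs_emp_le xp hW0 fun x => by
    rw [abs_of_pos (T.w_pos x)]; exact hW x)
  have e : A.grad xp xq θ₁ t - A.grad xp xq θ₂ t - ∑ s, A.hess xp xq t s * (θ₁ s - θ₂ s)
      = emp xp A.w * (emp xq (fun x => A.h x t * A.tilt θ₁ x) / emp xq (A.tilt θ₁)
        - emp xq (fun x => A.h x t * A.tilt θ₂ x) / emp xq (A.tilt θ₂)
        - (τ / emp xq (A.tilt A.θs) - emp xq (fun x => A.h x t * A.tilt A.θs x) * β
          / emp xq (A.tilt A.θs) ^ 2)) := by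
    have e1 : ∑ s, A.hess xp xq t s * (θ₁ s - θ₂ s)
        = emp xp A.w * (τ / emp xq (A.tilt A.θs) - emp xq (fun x => A.h x t * A.tilt A.θs x) * β
          / emp xq (A.tilt A.θs) ^ 2) := by
      rw [hτ, hβ, Finset.mul_sum, Finset.sum_div, Finset.sum_div, ← Finset.sum_sub_distrib,
        Finset.mul_sum]
      refine Finset.sum_congr rfl fun s _ => ?_
      simp only [hess, Matrix.of_apply]
      ring
    rw [e1]
    unfold grad
    ring
  rw [e, abs_mul, abs_of_nonneg hb0, mul_assoc]
  exact mul_le_mul hbW main (abs_nonneg _) hW0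

end TiltBounded

end Model

/-! ### Concentration of the empirical moments of the inliers -/

section Hoeffding

variable {X Ω : Type*} [MeasurableSpace X] [MeasurableSpace Ω] {μ : Measure Ω}
  [IsProbabilityMeasure μ] {P : Measure X} {n : ℕ} {Y : Fin n → Ω → X}

lemma measurable_emp (hY : ∀ i, Measurable (Y i)) {f : X → ℝ} (hf : Measurable f) :
    Measurable fun ω => emp (fun i => Y i ω) f := by
  unfold emp
  exact (Finset.measurable_sum _ fun i _ => hf.comp (hY i)).div_const _

/-- One-sided Hoeffding bound for an empirical mean. -/
lemma measure_lt_emp_sub_le (hn : 0 < n) (hY : ∀ i, Measurable (Y i)) (hP : ∀ i, μ.map (Y i) = P)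
    (hind : iIndepFun Y μ) {f : X → ℝ} (hf : Measurable f) {B : ℝ} (hB : 0 < B)
    (hfB : ∀ x, |f x| ≤ B) {l : ℝ} (hl : 0 ≤ l) :
    μ.real {ω | 2 * B * √(l / n) < emp (fun i => Y i ω) f - ∫ x, f x ∂P} ≤ Real.exp (-2 * l) := by
  set e := ∫ x, f x ∂P with he
  have hn' : (0 : ℝ) < n := by exact_mod_cast hn
  have hsub : ∀ i ∈ (Finset.univ : Finset (Fin n)),
      HasSubgaussianMGF (fun ω => f (Y i ω) - e) ((‖(B - e) - (-B - e)‖₊ / 2) ^ 2) μ := by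
    intro i _
    refine hasSubgaussianMGF_of_mem_Icc_of_integral_eq_zero ?_ ?_ ?_
    · exact ((hf.comp (hY i)).sub_const e).aemeasurable
    · refine ae_of_all _ fun ω => ?_
      have := abs_le.1 (hfB (Y i ω))
      constructor <;> linarith
    · have hint : Integrable (fun ω => f (Y i ω)) μ :=
        Integrable.of_bound (hf.comp (hY i)).aestronglyMeasurable B
          (ae_of_all _ fun ω => hfB (Y i ω))
      rw [integral_sub hint (integrable_const e), integral_const, probReal_univ, one_smul,
        ← integral_map (hY i).aemeasurable (f := f) hf.aestronglyMeasurable, hP i, he, sub_self]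
  have hind' : iIndepFun (fun i ω => f (Y i ω) - e) μ :=
    hind.comp (fun _ x => f x - e) fun _ => hf.sub_const e
  have h0 : 0 ≤ n * (2 * B * √(l / n)) := by positivity
  have h1 := HasSubgaussianMGF.measure_sum_ge_le_of_iIndepFun hind' hsub h0
  have hset : {ω | 2 * B * √(l / n) < emp (fun i => Y i ω) f - e}
      ⊆ {ω | n * (2 * B * √(l / n)) ≤ ∑ i, (f (Y i ω) - e)} := by
    intro ω hω
    simp only [Set.mem_ofPred_eq, emp, Fintype.card_fin] at hω ⊢
    rw [Finset.sum_sub_distrib, Finset.sum_const, Finset.card_univ, Fintype.card_fin,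
      nsmul_eq_mul]
    have h2 : (∑ i, f (Y i ω)) = n * ((∑ i, f (Y i ω)) / n) := by field_simp
    rw [h2, ← mul_sub]
    exact mul_le_mul_of_nonneg_left hω.le hn'.le
  refine (measureReal_mono hset).trans (h1.trans_eq ?_)
  congr 1
  have h3 : (((‖(B - e) - (-B - e)‖₊ / 2) ^ 2 : NNReal) : ℝ) = B ^ 2 := by
    have : (B - e) - (-B - e) = 2 * B := by ring
    rw [this]
    push_cast
    rw [Real.norm_of_nonneg (by positivity)]
    ring
  simp only [Finset.sum_const, Finset.card_univ, Fintype.card_fin, nsmul_eq_mul, NNReal.coe_mul,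
    NNReal.coe_natCast, h3]
  rw [mul_pow, mul_pow, Real.sq_sqrt (by positivity)]
  field_simp

lemma measure_lt_abs_emp_sub_le (hn : 0 < n) (hY : ∀ i, Measurable (Y i))
    (hP : ∀ i, μ.map (Y i) = P) (hind : iIndepFun Y μ) {f : X → ℝ} (hf : Measurable f) {B : ℝ}
    (hB : 0 < B) (hfB : ∀ x, |f x| ≤ B) {l : ℝ} (hl : 0 ≤ l) :
    μ.real {ω | 2 * B * √(l / n) < |emp (fun i => Y i ω) f - ∫ x, f x ∂P|}
      ≤ 2 * Real.exp (-2 * l) := by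
  have h1 := measure_lt_emp_sub_le hn hY hP hind hf hB hfB hl
  have h2 := measure_lt_emp_sub_le hn hY hP hind hf.neg hB (fun x => by simpa using hfB x) hl
  refine (measureReal_mono ?_).trans ((measureReal_union_le _ _).trans
    ((add_le_add h1 h2).trans_eq (two_mul _).symm))
  intro ω hω
  have hneg : emp (fun i => Y i ω) (-f) - ∫ x, (-f) x ∂P
      = -(emp (fun i => Y i ω) f - ∫ x, f x ∂P) := by
    simp only [emp, Pi.neg_apply, Finset.sum_neg_distrib, integral_neg]
    ring
  simp only [Set.mem_ofPred_eq, Set.mem_union, hneg] at hω ⊢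
  exact lt_abs.1 hω

/-- Union bound over a finite family of bounded functions. -/
lemma measure_exists_lt_abs_emp_sub_le {J : Type*} [Fintype J] (hn : 0 < n)
    (hY : ∀ i, Measurable (Y i)) (hP : ∀ i, μ.map (Y i) = P) (hind : iIndepFun Y μ)
    {f : J → X → ℝ} (hf : ∀ j, Measurable (f j)) {B : ℝ} (hB : 0 < B)
    (hfB : ∀ j x, |f j x| ≤ B) {l : ℝ} (hl : 0 ≤ l) :
    μ.real {ω | ∃ j, 2 * B * √(l / n) < |emp (fun i => Y i ω) (f j) - ∫ x, f j x ∂P|}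
      ≤ Fintype.card J * (2 * Real.exp (-2 * l)) := by
  have h1 : {ω | ∃ j, 2 * B * √(l / n) < |emp (fun i => Y i ω) (f j) - ∫ x, f j x ∂P|}
      = ⋃ j, {ω | 2 * B * √(l / n) < |emp (fun i => Y i ω) (f j) - ∫ x, f j x ∂P|} := by
    ext ω
    simp
  rw [h1]
  refine (measureReal_iUnion_fintype_le _).trans ?_
  refine (Finset.sum_le_sum fun j _ =>
    measure_lt_abs_emp_sub_le hn hY hP hind (hf j) hB (hfB j) hl).trans_eq ?_
  simp

end Hoeffding

namespace Model

variable {m d : ℕ} (A : Model m d)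

/-- The features together with the constant function `1`, so that moments of order zero, one and
two are products of two of these functions. -/
def feat (i : Option (Fin d)) (x : EuclideanSpace ℝ (Fin m)) : ℝ := i.elim 1 fun t => A.h x t

@[simp] lemma feat_none (x : EuclideanSpace ℝ (Fin m)) : A.feat none x = 1 := rfl

@[simp] lemma feat_some (t : Fin d) (x : EuclideanSpace ℝ (Fin m)) :
    A.feat (some t) x = A.h x t := rfl

/-- The empirical moments of the two samples are within `s` of the population moments. -/
structure Concentrated {ι κ : Type*} [Fintype ι] [Fintype κ] (xp : ι → EuclideanSpace ℝ (Fin m))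
    (xq : κ → EuclideanSpace ℝ (Fin m)) (s : ℝ) : Prop where
  ref : ∀ i, |emp xp (fun x => A.feat i x * A.w x) - ∫ x, A.feat i x * A.w x ∂A.P| ≤ s
  target : ∀ i j, |emp xq (fun x => A.feat i x * A.feat j x * A.tilt A.θs x)
    - ∫ x, A.feat i x * A.feat j x * A.tilt A.θs x ∂A.Q| ≤ s

lemma measurable_feat (hV : A.IsValid) (i : Option (Fin d)) : Measurable (A.feat i) := by
  have := hV.measurable_h
  cases i with
  | none => exact measurable_const
  | some t => exact (by fun_prop : Measurable fun x => A.h x t)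

lemma measurable_tilt (hV : A.IsValid) (θ : EuclideanSpace ℝ (Fin d)) : Measurable (A.tilt θ) := by
  have h1 := hV.measurable_h
  have h2 := hV.measurable_w
  unfold tilt
  fun_prop

theorem exists_concentration_event (hV : A.IsValid) (hd : 2 ≤ d) {B δ : ℝ} (hB : 0 < B)
    (hδ : 0 < δ) (hδ1 : δ < 1) (hwB : ∀ i x, |A.feat i x * A.w x| ≤ B)
    (htB : ∀ i j x, |A.feat i x * A.feat j x * A.tilt A.θs x| ≤ B)
    {np nq : ℕ} (hnp : 0 < np) (hnq : 0 < nq)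
    {Ω : Type*} [MeasurableSpace Ω] (μ : Measure Ω) [IsProbabilityMeasure μ]
    (Xp : Fin np → Ω → EuclideanSpace ℝ (Fin m)) (Xq : Fin nq → Ω → EuclideanSpace ℝ (Fin m))
    (mp : ∀ i, Measurable (Xp i)) (lp : ∀ i, μ.map (Xp i) = A.P) (ip : iIndepFun Xp μ)
    (mq : ∀ i, Measurable (Xq i)) (lq : ∀ i, μ.map (Xq i) = A.Q) (iq : iIndepFun Xq μ) :
    ∃ G : Set Ω, MeasurableSet G ∧ ENNReal.ofReal (1 - 8 * δ) ≤ μ G ∧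
      ∀ ω ∈ G, A.Concentrated (fun i => Xp i ω) (fun i => Xq i ω)
        (2 * B * √(Real.log (6 * d / δ) / ((min np nq : ℕ) : ℝ))) := by
  have hd' : (2 : ℝ) ≤ d := by exact_mod_cast hd
  set l := Real.log (6 * d / δ) with hl
  have hratio : 1 ≤ 6 * d / δ := by
    rw [le_div_iff₀ hδ]; linarith
  have hl0 : 0 ≤ l := Real.log_nonneg hratio
  have hexp : Real.exp (-2 * l) = (δ / (6 * d)) ^ 2 := by
    have : -2 * l = -l + -l := by ring
    rw [this, Real.exp_add, Real.exp_neg, hl, Real.exp_log (by linarith), inv_div, sq]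
  have mfw : ∀ i, Measurable fun x => A.feat i x * A.w x := fun i =>
    (A.measurable_feat hV i).mul hV.measurable_w
  have mft : ∀ i : Option (Fin d) × Option (Fin d),
      Measurable fun x => A.feat i.1 x * A.feat i.2 x * A.tilt A.θs x := fun i =>
    ((A.measurable_feat hV i.1).mul (A.measurable_feat hV i.2)).mul (A.measurable_tilt hV _)
  set Ep := {ω | ∃ i, 2 * B * √(l / np) < |emp (fun n => Xp n ω) (fun x => A.feat i x * A.w x)
    - ∫ x, A.feat i x * A.w x ∂A.P|} with hEp
  set Eq := {ω | ∃ i : Option (Fin d) × Option (Fin d), 2 * B * √(l / nq)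
    < |emp (fun n => Xq n ω) (fun x => A.feat i.1 x * A.feat i.2 x * A.tilt A.θs x)
    - ∫ x, A.feat i.1 x * A.feat i.2 x * A.tilt A.θs x ∂A.Q|} with hEq
  have bp : μ.real Ep ≤ _ := measure_exists_lt_abs_emp_sub_le hnp mp lp ip mfw hB hwB hl0
  have bq : μ.real Eq ≤ _ := measure_exists_lt_abs_emp_sub_le hnq mq lq iq mft hB
    (fun i => htB i.1 i.2) hl0
  rw [hexp] at bp bq
  simp only [Fintype.card_prod, Fintype.card_option, Fintype.card_fin] at bp bq
  push_cast at bp bq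
  have mEp : MeasurableSet Ep := by
    simp only [hEp, Set.ofPred_exists]
    exact MeasurableSet.iUnion fun i => measurableSet_lt measurable_const
      ((measurable_emp mp (mfw i)).sub_const _).abs
  have mEq : MeasurableSet Eq := by
    simp only [hEq, Set.ofPred_exists]
    exact MeasurableSet.iUnion fun i => measurableSet_lt measurable_const
      ((measurable_emp mq (mft i)).sub_const _).abs
  refine ⟨(Ep ∪ Eq)ᶜ, (mEp.union mEq).compl, ?_, ?_⟩
  · have h1 : 1 - 8 * δ ≤ μ.real (Ep ∪ Eq)ᶜ := by
      rw [probReal_compl_eq_one_sub (mEp.union mEq)]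
      have h2 : μ.real (Ep ∪ Eq) ≤ 8 * δ := by
        refine (measureReal_union_le _ _).trans ((add_le_add bp bq).trans ?_)
        have h3 : ((d : ℝ) + 1) * (2 * (δ / (6 * d)) ^ 2)
            + ((d : ℝ) + 1) * (d + 1) * (2 * (δ / (6 * d)) ^ 2)
            = ((d + 1) * (d + 2)) / (18 * d ^ 2) * δ ^ 2 := by
          field_simp
          ring
        rw [h3]
        have h4 : (((d : ℝ) + 1) * (d + 2)) / (18 * d ^ 2) ≤ 1 := by
          rw [div_le_one (by positivity)]
          nlinarith
        calc _ ≤ 1 * δ ^ 2 := by gcongr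
          _ ≤ 8 * δ := by nlinarith
      linarith
    rw [← ofReal_measureReal]
    exact ENNReal.ofReal_le_ofReal h1
  · intro ω hω
    have hω1 : ω ∉ Ep := fun h => hω (Or.inl h)
    have hω2 : ω ∉ Eq := fun h => hω (Or.inr h)
    simp only [hEp, hEq, Set.mem_ofPred_eq, not_exists, not_lt] at hω1 hω2
    have hmono : ∀ n : ℕ, min np nq ≤ n →
        2 * B * √(l / n) ≤ 2 * B * √(l / ((min np nq : ℕ) : ℝ)) := fun n hn => by
      have h0 : (0 : ℝ) < ((min np nq : ℕ) : ℝ) := by exact_mod_cast lt_min hnp hnq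
      have h1 : ((min np nq : ℕ) : ℝ) ≤ n := by exact_mod_cast hn
      gcongr
    exact ⟨fun i => (hω1 i).trans (hmono np (min_le_left _ _)),
      fun i j => (hω2 (i, j)).trans (hmono nq (min_le_right _ _))⟩

end Model

/-! ### Contaminated moments -/

lemma contam_nonneg (n o : ℕ) : 0 ≤ contam n o := by unfold contam; positivity

lemma one_sub_contam {n : ℕ} (hn : 0 < n) (o : ℕ) :
    1 - contam n o = (n : ℝ) / ((n : ℝ) + o) := by
  have : (0 : ℝ) < n := by exact_mod_cast hn
  unfold contam
  field_simp
  ring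

/-- An empirical mean over a contaminated sample, divided by the proportion of inliers, differs from
the mean over the inliers by at most the odds of an outlier times the size of `f` there. -/
lemma abs_emp_merge_sub_le {X : Type*} {n o : ℕ} (hn : 0 < n) (x : Fin n → X) (z : Fin o → X)
    {f : X → ℝ} {ν e : ℝ} (hf : ∀ i, |f (z i)| ≤ ν) :
    |emp (merge x z) f / (1 - contam n o) - e|
      ≤ |emp x f - e| + contam n o * ν / (1 - contam n o) := by
  have hn' : (0 : ℝ) < n := by exact_mod_cast hn
  have h1 : emp (merge x z) f / (1 - contam n o) = emp x f + (∑ i, f (z i)) / n := by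
    rw [one_sub_contam hn]
    simp only [emp, merge, Fintype.sum_sum_type, Sum.elim_inl, Sum.elim_inr, Fintype.card_sum,
      Fintype.card_fin]
    push_cast
    field_simp
  have h2 : contam n o * ν / (1 - contam n o) = o * ν / n := by
    rw [one_sub_contam hn]
    unfold contam
    field_simp
  have h3 : |(∑ i, f (z i)) / (n : ℝ)| ≤ o * ν / n := by
    rw [abs_div, abs_of_pos hn']
    gcongr
    refine (Finset.abs_sum_le_sum_abs _ _).trans ((Finset.sum_le_sum fun i _ => hf i).trans ?_)
    simp
  rw [h1, h2, add_sub_right_comm]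
  exact (abs_add_le _ _).trans (add_le_add le_rfl h3)

/-! ### Perturbation of quotients -/

/-- Lipschitz constant of the quotient in `abs_div_sub_div_le`. -/
def quotConst (B E : ℝ) : ℝ := 2 / E + 2 * B / E ^ 2

/-- Lipschitz constant of the gradient at `θs` as a function of the moments. -/
def gradConst (B E : ℝ) : ℝ := 1 + (B + 1) * quotConst B E + B / E

/-- Lipschitz constant of the Hessian at `θs` as a function of the moments. -/
def hessConst (B E : ℝ) : ℝ :=
  (B + 1) * (quotConst B E * (1 + 2 * (B / E) + quotConst B E)) + (B / E + (B / E) ^ 2)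

lemma quotConst_pos {B E : ℝ} (hB : 0 < B) (hE : 0 < E) : 0 < quotConst B E := by
  unfold quotConst; positivity

lemma gradConst_pos {B E : ℝ} (hB : 0 < B) (hE : 0 < E) : 0 < gradConst B E := by
  have := quotConst_pos hB hE
  unfold gradConst; positivity

lemma hessConst_pos {B E : ℝ} (hB : 0 < B) (hE : 0 < E) : 0 < hessConst B E := by
  have := quotConst_pos hB hE
  unfold hessConst; positivity

lemma abs_div_sub_div_le {u v U Z B E ξ : ℝ} (hE : 0 < E) (hU : |U| ≤ B) (hZ : E ≤ Z)
    (hu : |u - U| ≤ ξ) (hv : |v - Z| ≤ ξ) (hξ : ξ ≤ E / 2) :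
    |u / v - U / Z| ≤ quotConst B E * ξ := by
  have hvE : E / 2 ≤ v := by have := (abs_le.1 hv).1; linarith
  have hv0 : 0 < v := (half_pos hE).trans_le hvE
  have hZ0 : 0 < Z := hE.trans_le hZ
  have e : u / v - U / Z = (u - U) / v - U * (v - Z) / (v * Z) := by
    field_simp
    ring
  have b1 := abs_div_le_div hu (half_pos hE) hvE
  have b2 : |U * (v - Z) / (v * Z)| ≤ B * ξ / (E / 2 * E) := by
    refine abs_div_le_div ?_ (by positivity) ?_
    · rw [abs_mul]
      exact mul_le_mul hU hv (abs_nonneg _) ((abs_nonneg _).trans hU)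
    · exact mul_le_mul hvE hZ hE.le hv0.le
  rw [e]
  refine (abs_sub _ _).trans ((add_le_add b1 b2).trans_eq ?_)
  unfold quotConst
  field_simp

lemma abs_mul_sub_mul_le {b q W Q β Q₀ x y : ℝ} (hb : |b| ≤ β) (hQ : |Q| ≤ Q₀)
    (hx : |b - W| ≤ x) (hy : |q - Q| ≤ y) : |b * q - W * Q| ≤ β * y + Q₀ * x := by
  have e : b * q - W * Q = b * (q - Q) + Q * (b - W) := by ring
  rw [e]
  refine (abs_add_le _ _).trans ?_
  rw [abs_mul, abs_mul]
  have := (abs_nonneg _).trans hb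
  have := (abs_nonneg _).trans hQ
  gcongr

lemma abs_gradient_le {a b u v A₀ W U Z B E ξ : ℝ} (hE : 0 < E) (hW : |W| ≤ B)
    (hU : |U| ≤ B) (hZ : E ≤ Z) (hA : A₀ = W * (U / Z)) (ha : |a - A₀| ≤ ξ) (hb : |b - W| ≤ ξ)
    (hu : |u - U| ≤ ξ) (hv : |v - Z| ≤ ξ) (hξ : ξ ≤ E / 2) (hξ1 : ξ ≤ 1) :
    |-a + b * (u / v)| ≤ gradConst B E * ξ := by
  have hq := abs_div_sub_div_le hE hU hZ hu hv hξ
  have hQ : |U / Z| ≤ B / E := abs_div_le_div hU hE hZ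
  have hbB : |b| ≤ B + 1 := by
    have := abs_sub_abs_le_abs_sub b W
    linarith
  have h1 := abs_mul_sub_mul_le hbB hQ hb hq
  have e : -a + b * (u / v) = (b * (u / v) - W * (U / Z)) - (a - A₀) := by rw [hA]; ring
  rw [e]
  refine (abs_sub _ _).trans ((add_le_add h1 ha).trans_eq ?_)
  unfold gradConst
  ring

lemma abs_hessian_sub_le {b u u' T' v W U U' T Z B E ξ : ℝ} (hB : 0 < B) (hE : 0 < E)
    (hW : |W| ≤ B) (hU : |U| ≤ B) (hU' : |U'| ≤ B) (hT : |T| ≤ B) (hZ : E ≤ Z)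
    (hb : |b - W| ≤ ξ) (hu : |u - U| ≤ ξ) (hu' : |u' - U'| ≤ ξ) (hT' : |T' - T| ≤ ξ)
    (hv : |v - Z| ≤ ξ) (hξ : ξ ≤ E / 2) (hξ1 : ξ ≤ 1) :
    |b * (T' / v - (u / v) * (u' / v)) - W * (T / Z - (U / Z) * (U' / Z))|
      ≤ hessConst B E * ξ := by
  have hK := quotConst_pos hB hE
  have hq := abs_div_sub_div_le hE hU hZ hu hv hξ
  have hq' := abs_div_sub_div_le hE hU' hZ hu' hv hξ
  have hqT := abs_div_sub_div_le hE hT hZ hT' hv hξ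
  have hQ : |U / Z| ≤ B / E := abs_div_le_div hU hE hZ
  have hQ' : |U' / Z| ≤ B / E := abs_div_le_div hU' hE hZ
  have hQT : |T / Z| ≤ B / E := abs_div_le_div hT hE hZ
  have hbB : |b| ≤ B + 1 := by
    have := abs_sub_abs_le_abs_sub b W
    linarith
  have hqB : |u / v| ≤ B / E + quotConst B E := by
    have h1 := abs_sub_abs_le_abs_sub (u / v) (U / Z)
    have h2 : quotConst B E * ξ ≤ quotConst B E * 1 := by gcongr
    linarith
  have h1 := abs_mul_sub_mul_le hqB hQ' hq hq'
  have h2 : |(T' / v - (u / v) * (u' / v)) - (T / Z - (U / Z) * (U' / Z))|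
      ≤ quotConst B E * (1 + 2 * (B / E) + quotConst B E) * ξ := by
    have e : (T' / v - (u / v) * (u' / v)) - (T / Z - (U / Z) * (U' / Z))
        = (T' / v - T / Z) - ((u / v) * (u' / v) - (U / Z) * (U' / Z)) := by ring
    rw [e]
    refine (abs_sub _ _).trans ((add_le_add hqT h1).trans_eq ?_)
    ring
  have h3 : |T / Z - (U / Z) * (U' / Z)| ≤ B / E + (B / E) ^ 2 := by
    refine (abs_sub _ _).trans (add_le_add hQT ?_)
    rw [abs_mul, sq]
    exact mul_le_mul hQ hQ' (abs_nonneg _) ((abs_nonneg _).trans hQ)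
  refine (abs_mul_sub_mul_le hbB h3 hb h2).trans_eq ?_
  unfold hessConst
  ring

namespace Model

variable {m d : ℕ} (A : Model m d)

/-! ### Population identities -/

/-- The population moment of order at most one of the reference law. -/
def refMoment (i : Option (Fin d)) : ℝ := ∫ x, A.feat i x * A.w x ∂A.P

/-- The tilted population moment of order at most two of the target law. -/
def targetMoment (i j : Option (Fin d)) : ℝ :=
  ∫ x, A.feat i x * A.feat j x * A.tilt A.θs x ∂A.Q

lemma refMoment_none : A.refMoment none = ∫ x, A.w x ∂A.P := by simp [refMoment]

lemma targetMoment_none : A.targetMoment none none = ∫ x, A.tilt A.θs x ∂A.Q := by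
  simp [targetMoment]

lemma integral_ratio_mul (g : EuclideanSpace ℝ (Fin m) → ℝ) :
    ∫ x, A.ratio A.θs x * A.w x * g x ∂A.Q = A.normConst A.θs * ∫ x, g x * A.tilt A.θs x ∂A.Q := by
  rw [← integral_const_mul]
  congr 1
  ext x
  unfold ratio tilt
  ring

/-- The score has mean zero at the true parameter, because `P` has density `ratio θs` with respect
to `Q`. -/
lemma refMoment_some (hV : A.IsValid) (hC : 0 ≤ A.normConst A.θs) (t : Fin d) :
    A.refMoment (some t) = A.refMoment none
      * (A.targetMoment (some t) none / A.targetMoment none none) := by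
  have hmeas : Measurable fun x => ENNReal.ofReal (A.ratio A.θs x) := by
    have := hV.measurable_h
    unfold ratio
    fun_prop
  have h1 : A.refMoment (some t) = ∫ x, A.ratio A.θs x * A.w x * A.h x t ∂A.Q := by
    unfold refMoment
    rw [hV.density, integral_withDensity_eq_integral_toReal_smul hmeas
      (ae_of_all _ fun _ => ENNReal.ofReal_lt_top)]
    congr 1
    ext x
    have hr : 0 ≤ A.ratio A.θs x := mul_nonneg hC (Real.exp_pos _).le
    rw [ENNReal.toReal_ofReal hr, smul_eq_mul, feat_some]
    ring
  rw [h1, A.integral_ratio_mul (fun x => A.h x t), refMoment_none, targetMoment_none, normConst]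
  simp only [targetMoment, feat_some, feat_none, mul_one]
  ring

lemma fisher_eq (hW : ∫ x, A.w x ∂A.P ≠ 0) (t s : Fin d) :
    A.fisher A.θs t s = A.refMoment none
      * (A.targetMoment (some t) (some s) / A.targetMoment none none
        - A.targetMoment (some t) none / A.targetMoment none none
          * (A.targetMoment (some s) none / A.targetMoment none none)) := by
  simp only [fisher, Matrix.of_apply]
  rw [A.integral_ratio_mul (fun x => A.h x t * A.h x s), A.integral_ratio_mul (fun x => A.h x t),
    A.integral_ratio_mul (fun x => A.h x s), refMoment_none, targetMoment_none, normConst]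
  simp only [targetMoment, feat_some, feat_none, mul_one]
  field_simp

/-! ### Size of the outliers -/

lemma tilt_abs_eq (hw : ∀ x, 0 < A.w x) (θ : EuclideanSpace ℝ (Fin d))
    (x : EuclideanSpace ℝ (Fin m)) (a : ℝ) : |a * A.tilt θ x| = A.tilt θ x * |a| := by
  rw [abs_mul, abs_of_pos (A.tilt_pos hw θ x), mul_comm]

section Outliers

variable {op oq : ℕ} (zp : Fin op → EuclideanSpace ℝ (Fin m))
  (zq : Fin oq → EuclideanSpace ℝ (Fin m))

lemma ν_nonneg (hw : ∀ x, 0 < A.w x) : 0 ≤ A.ν zp zq :=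
  (Real.iSup_nonneg fun _ => (hw _).le : 0 ≤ A.ν₁ zp).trans (le_max_left _ _)

lemma abs_ref_outlier_le (hw : ∀ x, 0 < A.w x) (i : Option (Fin d)) (n : Fin op) :
    |A.feat i (zp n) * A.w (zp n)| ≤ A.ν zp zq := by
  rw [abs_mul, abs_of_pos (hw _), mul_comm]
  cases i with
  | none =>
    rw [feat_none, abs_one, mul_one]
    refine le_trans ?_ (le_max_left _ _)
    exact le_ciSup (f := fun n => A.w (zp n)) (Set.finite_range _).bddAbove n
  | some t =>
    rw [feat_some]
    refine le_trans ?_ ((le_max_left _ _).trans ((le_max_right _ _).trans (le_max_right _ _)))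
    refine le_trans ?_ (le_ciSup (f := fun t => ⨆ n, A.w (zp n) * |A.h (zp n) t|)
      (Set.finite_range _).bddAbove t)
    exact le_ciSup (f := fun n => A.w (zp n) * |A.h (zp n) t|) (Set.finite_range _).bddAbove n

lemma abs_target_outlier_le {Emax Emin Dmax : ℝ} (hw : ∀ x, 0 < A.w x)
    (hR : A.RatioBounded Emax Emin) (hF : A.FeatureBounded Dmax) (hθ : A.θs ∈ A.Θ)
    (i j : Option (Fin d)) (n : Fin oq) :
    |A.feat i (zq n) * A.feat j (zq n) * A.tilt A.θs (zq n)| ≤ A.ν zp zq := by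
  -- the suprema over the parameter set are of bounded families
  have sup_le : ∀ (a : EuclideanSpace ℝ (Fin m) → ℝ) (C : ℝ),
      (∀ θ ∈ A.Θ, ∀ x, A.tilt θ x * a x ≤ C) → ∀ n : Fin oq,
      A.tilt A.θs (zq n) * a (zq n) ≤ ⨆ n, ⨆ θ : A.Θ, A.tilt θ (zq n) * a (zq n) := by
    intro a C hC n
    refine le_trans ?_ (le_ciSup (f := fun n => ⨆ θ : A.Θ, A.tilt θ (zq n) * a (zq n))
      (Set.finite_range _).bddAbove n)
    refine le_ciSup (f := fun θ : A.Θ => A.tilt θ (zq n) * a (zq n)) ⟨C, ?_⟩ ⟨A.θs, hθ⟩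
    rintro _ ⟨θ, rfl⟩
    exact hC θ θ.2 _
  have b4 : ∀ t, A.tilt A.θs (zq n) * |A.h (zq n) t| ≤ A.ν zp zq := fun t => by
    refine le_trans ?_ ((le_max_left _ _).trans ((le_max_right _ _).trans
      ((le_max_right _ _).trans (le_max_right _ _))))
    refine (sup_le (fun x => |A.h x t|) Dmax (fun θ hθ x => ?_) n).trans
      (le_ciSup (f := fun t => ⨆ n, ⨆ θ : A.Θ, A.tilt θ (zq n) * |A.h (zq n) t|)
      (Set.finite_range _).bddAbove t)
    have := (hF θ hθ x).2.1 t
    rwa [A.tilt_abs_eq hw] at this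
  rw [A.tilt_abs_eq hw]
  rcases i with _ | t <;> rcases j with _ | s <;> simp only [feat_none, feat_some, mul_one, one_mul]
  · rw [abs_one, mul_one]
    refine le_trans ?_ ((le_max_left _ _).trans (le_max_right _ _))
    have h := sup_le (fun _ => 1) Emax (fun θ hθ x => by
      rw [mul_one]; exact (hR θ hθ).1 x) n
    simp only [mul_one] at h
    exact h
  · exact b4 s
  · exact b4 t
  · refine le_trans ?_ ((le_max_left _ _).trans ((le_max_right _ _).trans
      ((le_max_right _ _).trans ((le_max_right _ _).trans (le_max_right _ _)))))
    refine (sup_le (fun x => |A.h x t * A.h x s|) Dmax (fun θ hθ x => ?_) n).trans ?_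
    · have := (hF θ hθ x).2.2.1 t s
      rwa [A.tilt_abs_eq hw] at this
    · refine (le_ciSup (f := fun s => ⨆ n, ⨆ θ : A.Θ, A.tilt θ (zq n) *
        |A.h (zq n) t * A.h (zq n) s|) (Set.finite_range _).bddAbove s).trans ?_
      exact le_ciSup (f := fun t => ⨆ s, ⨆ n, ⨆ θ : A.Θ, A.tilt θ (zq n) *
        |A.h (zq n) t * A.h (zq n) s|) (Set.finite_range _).bddAbove t

end Outliers

/-! ### Gradient and Hessian at the true parameter -/

/-- The contaminated moments, divided by the proportions of inliers, are within `ξ` of the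
population moments. -/
structure MomentsClose {ι κ : Type*} [Fintype ι] [Fintype κ]
    (xp : ι → EuclideanSpace ℝ (Fin m)) (xq : κ → EuclideanSpace ℝ (Fin m))
    (cp cq ξ : ℝ) : Prop where
  ref : ∀ i, |emp xp (fun x => A.feat i x * A.w x) / cp - A.refMoment i| ≤ ξ
  target : ∀ i j, |emp xq (fun x => A.feat i x * A.feat j x * A.tilt A.θs x) / cq
    - A.targetMoment i j| ≤ ξ

variable {A}

lemma Concentrated.momentsClose {np nq op oq : ℕ} (hnp : 0 < np) (hnq : 0 < nq)
    {xp : Fin np → EuclideanSpace ℝ (Fin m)} {xq : Fin nq → EuclideanSpace ℝ (Fin m)}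
    {zp : Fin op → EuclideanSpace ℝ (Fin m)} {zq : Fin oq → EuclideanSpace ℝ (Fin m)}
    {s εbar ν : ℝ} (H : A.Concentrated xp xq s) (hp : contam np op ≤ εbar)
    (hq : contam nq oq ≤ εbar) (hε : εbar < 1) (hν : 0 ≤ ν)
    (hzp : ∀ i n, |A.feat i (zp n) * A.w (zp n)| ≤ ν)
    (hzq : ∀ i j n, |A.feat i (zq n) * A.feat j (zq n) * A.tilt A.θs (zq n)| ≤ ν) :
    A.MomentsClose (merge xp zp) (merge xq zq) (1 - contam np op) (1 - contam nq oq)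
      (s + max (contam np op) (contam nq oq) * ν / (1 - εbar)) := by
  have h1 : 0 < 1 - εbar := by linarith
  have hmax : 0 ≤ max (contam np op) (contam nq oq) := (contam_nonneg _ _).trans (le_max_left _ _)
  constructor
  · intro i
    refine (abs_emp_merge_sub_le hnp xp zp (f := fun x => A.feat i x * A.w x)
      (hzp i)).trans (add_le_add (H.ref i) ?_)
    gcongr
    exact le_max_left _ _
  · intro i j
    refine (abs_emp_merge_sub_le hnq xq zq (f := fun x => A.feat i x * A.feat j x * A.tilt A.θs x)
      (hzq i j)).trans (add_le_add (H.target i j) ?_)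
    gcongr
    exact le_max_right _ _

/-- Bounds on the population moments. -/
structure PopulationBounded (A : Model m d) (B E : ℝ) : Prop where
  B_pos : 0 < B
  E_pos : 0 < E
  w_pos : 0 < ∫ x, A.w x ∂A.P
  ref_le : ∀ i, |A.refMoment i| ≤ B
  target_le : ∀ i j, |A.targetMoment i j| ≤ B
  le_norm : E ≤ A.targetMoment none none

namespace MomentsClose

variable {ι κ : Type*} [Fintype ι] [Fintype κ] {xp : ι → EuclideanSpace ℝ (Fin m)}
    {xq : κ → EuclideanSpace ℝ (Fin m)} {cp cq ξ B E : ℝ}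

lemma emp_tilt_ge (H : A.MomentsClose xp xq cp cq ξ) (hP : A.PopulationBounded B E)
    (hcq : 0 < cq) (hξ : ξ ≤ E / 2) : cq * (E / 2) ≤ emp xq (A.tilt A.θs) := by
  have h1 := (abs_le.1 (H.target none none)).1
  have h2 := hP.le_norm
  simp only [feat_none, mul_one, one_mul] at h1
  have h3 : E / 2 ≤ emp xq (A.tilt A.θs) / cq := by
    have h4 : emp xq (fun x => A.tilt A.θs x) = emp xq (A.tilt A.θs) := rfl
    rw [h4] at h1
    linarith
  rw [le_div_iff₀ hcq] at h3
  linarith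

lemma abs_grad_le (H : A.MomentsClose xp xq cp cq ξ) (hP : A.PopulationBounded B E)
    (hV : A.IsValid) (hcp : 0 < cp) (hcq : 0 < cq) (hξ : ξ ≤ E / 2) (hξ1 : ξ ≤ 1) (t : Fin d) :
    |A.grad xp xq A.θs t| ≤ cp * (gradConst B E * ξ) := by
  have hZ : 0 < A.targetMoment none none := hP.E_pos.trans_le hP.le_norm
  have hC : 0 ≤ A.normConst A.θs := by
    rw [normConst, ← targetMoment_none]
    exact div_nonneg hP.w_pos.le hZ.le
  have h1 := abs_gradient_le hP.E_pos (hP.ref_le none) (hP.target_le (some t) none)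
    hP.le_norm (A.refMoment_some hV hC t) (H.ref (some t)) (H.ref none) (H.target (some t) none)
    (H.target none none) hξ hξ1
  have h2 : A.grad xp xq A.θs t = cp * (-(emp xp (fun x => A.feat (some t) x * A.w x) / cp)
      + emp xp (fun x => A.feat none x * A.w x) / cp
        * (emp xq (fun x => A.feat (some t) x * A.feat none x * A.tilt A.θs x) / cq
          / (emp xq (fun x => A.feat none x * A.feat none x * A.tilt A.θs x) / cq))) := by
    simp only [feat_none, feat_some, mul_one, one_mul]
    rw [div_div_div_cancel_right₀ hcq.ne']
    unfold grad
    field_simp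
  rw [h2, abs_mul, abs_of_pos hcp]
  gcongr

lemma abs_hess_sub_le (H : A.MomentsClose xp xq cp cq ξ) (hP : A.PopulationBounded B E)
    (hcp : 0 < cp) (hcq : 0 < cq) (hξ : ξ ≤ E / 2) (hξ1 : ξ ≤ 1)
    (t s : Fin d) :
    |A.hess xp xq t s - cp * A.fisher A.θs t s| ≤ cp * (hessConst B E * ξ) := by
  have h1 := abs_hessian_sub_le hP.B_pos hP.E_pos (hP.ref_le none) (hP.target_le (some t) none)
    (hP.target_le (some s) none) (hP.target_le (some t) (some s))
    hP.le_norm (H.ref none) (H.target (some t) none) (H.target (some s) none)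
    (H.target (some t) (some s)) (H.target none none) hξ hξ1
  rw [← A.fisher_eq hP.w_pos.ne'] at h1
  have h2 : A.hess xp xq t s = cp * (emp xp (fun x => A.feat none x * A.w x) / cp
      * (emp xq (fun x => A.feat (some t) x * A.feat (some s) x * A.tilt A.θs x) / cq
          / (emp xq (fun x => A.feat none x * A.feat none x * A.tilt A.θs x) / cq)
        - emp xq (fun x => A.feat (some t) x * A.feat none x * A.tilt A.θs x) / cq
          / (emp xq (fun x => A.feat none x * A.feat none x * A.tilt A.θs x) / cq)
          * (emp xq (fun x => A.feat (some s) x * A.feat none x * A.tilt A.θs x) / cq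
          / (emp xq (fun x => A.feat none x * A.feat none x * A.tilt A.θs x) / cq)))) := by
    simp only [feat_none, feat_some, mul_one, one_mul]
    rw [div_div_div_cancel_right₀ hcq.ne', div_div_div_cancel_right₀ hcq.ne',
      div_div_div_cancel_right₀ hcq.ne', div_mul_div_comm, ← sq]
    simp only [hess, Matrix.of_apply]
    field_simp
  rw [h2, ← mul_sub, abs_mul, abs_of_pos hcp]
  gcongr

end MomentsClose

end Model

open Filter Topology

/-! ### Sample size and constants -/

/-- A common bound for all weighted moments of order at most two. -/
def boundConst (Wmax Emax Dmax : ℝ) : ℝ := |Wmax| + |Emax| + |Dmax| + 1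

lemma boundConst_pos (Wmax Emax Dmax : ℝ) : 0 < boundConst Wmax Emax Dmax := by
  unfold boundConst; positivity

lemma le_boundConst (Wmax Emax Dmax : ℝ) : Wmax ≤ boundConst Wmax Emax Dmax ∧
    Emax ≤ boundConst Wmax Emax Dmax ∧ Dmax ≤ boundConst Wmax Emax Dmax := by
  unfold boundConst
  have h1 := abs_nonneg Wmax
  have h2 := abs_nonneg Emax
  have h3 := abs_nonneg Dmax
  have h4 := le_abs_self Wmax
  have h5 := le_abs_self Emax
  have h6 := le_abs_self Dmax
  refine ⟨?_, ?_, ?_⟩ <;> linarith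

lemma eventually_mul_le (a : ℝ) {b : ℝ} (hb : 0 < b) : ∀ᶠ τ in 𝓝[>] (0 : ℝ), τ * a ≤ b := by
  have h1 : Tendsto (fun τ : ℝ => τ * a) (𝓝 0) (𝓝 (0 * a)) := tendsto_id.mul_const a
  rw [zero_mul] at h1
  exact (h1.mono_left nhdsWithin_le_nhds).eventually_le_const hb

/-- The constant by which `log d` must be multiplied to dominate `log (6 d / δ)` for `d ≥ 2`. -/
def logConst (δ : ℝ) : ℝ := 1 + Real.log (6 / δ) / Real.log 2

lemma logConst_pos {δ : ℝ} (hδ : 0 < δ) (hδ1 : δ < 1) : 0 < logConst δ := by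
  have h1 : 0 ≤ Real.log (6 / δ) := Real.log_nonneg (by rw [le_div_iff₀ hδ]; linarith)
  have h2 : 0 < Real.log 2 := Real.log_pos (by norm_num)
  unfold logConst
  positivity

lemma log_le_logConst_mul {δ : ℝ} (hδ : 0 < δ) (hδ1 : δ < 1) {d : ℕ} (hd : 2 ≤ d) :
    Real.log (6 * d / δ) ≤ logConst δ * Real.log d := by
  have hd' : (2 : ℝ) ≤ d := by exact_mod_cast hd
  have h1 : 0 ≤ Real.log (6 / δ) := Real.log_nonneg (by rw [le_div_iff₀ hδ]; linarith)
  have h2 : 0 < Real.log 2 := Real.log_pos (by norm_num)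
  have h3 : Real.log 2 ≤ Real.log d := Real.log_le_log (by norm_num) hd'
  have h4 : Real.log (6 * d / δ) = Real.log d + Real.log (6 / δ) := by
    rw [← Real.log_mul (by positivity) (by positivity)]
    congr 1; ring
  have h5 : Real.log (6 / δ) ≤ Real.log (6 / δ) / Real.log 2 * Real.log d := by
    rw [div_mul_eq_mul_div, le_div_iff₀ h2]
    gcongr
  unfold logConst
  linarith

/-- The sample size condition makes the statistical error small compared to `1 / k`. -/
lemma card_mul_sqrt_le {δ τ : ℝ} (hδ : 0 < δ) (hδ1 : δ < 1) (hτ : 0 < τ) {d k n : ℕ} (hd : 2 ≤ d)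
    (hk : 1 ≤ k) (hn : 4 * logConst δ / τ ^ 2 * (k : ℝ) ^ 3 * Real.log d ≤ n) :
    (k : ℝ) * √(Real.log (6 * d / δ) / n) ≤ τ / 2 := by
  have hk' : (1 : ℝ) ≤ k := by exact_mod_cast hk
  have hlog : 0 < Real.log d := Real.log_pos (by exact_mod_cast hd)
  have hA := logConst_pos hδ hδ1
  have hn0 : (0 : ℝ) < n := lt_of_lt_of_le (by positivity) hn
  refine abs_le_of_sq_le_sq' ?_ (by positivity) |>.2
  have hd' : (2 : ℝ) ≤ d := by exact_mod_cast hd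
  have hl0 : 0 ≤ Real.log (6 * d / δ) := Real.log_nonneg (by rw [le_div_iff₀ hδ]; linarith)
  rw [mul_pow, Real.sq_sqrt (by positivity), ← mul_div_assoc, div_le_iff₀ hn0]
  have h1 : (k : ℝ) ^ 2 ≤ (k : ℝ) ^ 3 := pow_le_pow_right₀ hk' (by norm_num)
  calc (k : ℝ) ^ 2 * Real.log (6 * d / δ)
      ≤ (k : ℝ) ^ 3 * (logConst δ * Real.log d) := by
        gcongr
        exact log_le_logConst_mul hδ hδ1 hd
    _ = (τ / 2) ^ 2 * (4 * logConst δ / τ ^ 2 * (k : ℝ) ^ 3 * Real.log d) := by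
        field_simp
        ring
    _ ≤ (τ / 2) ^ 2 * n := by gcongr

lemma rate_eq (a L M N lmin δ εp ε ν npq np : ℝ) (k d : ℕ) (hl : lmin ≠ 0) (hε : 1 - εp ≠ 0) :
    rate a L M N lmin δ εp ε ν npq np k d
      = a * √(k : ℝ) * regParam L M N δ εp ε ν npq np d / ((1 - εp) * lmin) := by
  unfold rate regParam
  rw [mul_div_assoc (k : ℝ), mul_div_assoc (k : ℝ), Real.sqrt_mul (Nat.cast_nonneg k),
    Real.sqrt_mul (Nat.cast_nonneg k)]
  field_simp

namespace Model

variable {m d : ℕ} {A : Model m d}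

lemma abs_feat_mul_w_le {Wmax Wmin Emax Dmax : ℝ} (hW : A.WeightBounded Wmax Wmin)
    (hF : A.FeatureBounded Dmax) (hθ : A.θs ∈ A.Θ) (i : Option (Fin d))
    (x : EuclideanSpace ℝ (Fin m)) : |A.feat i x * A.w x| ≤ boundConst Wmax Emax Dmax := by
  obtain ⟨b1, -, b3⟩ := le_boundConst Wmax Emax Dmax
  cases i with
  | none =>
    rw [feat_none, one_mul, abs_of_pos (hW.1 x).1]
    exact (hW.1 x).2.trans b1
  | some t => exact ((hF _ hθ x).1 t).trans b3

lemma abs_feat_mul_tilt_le {Wmax Wmin Emax Emin Dmax : ℝ} (hW : A.WeightBounded Wmax Wmin)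
    (hR : A.RatioBounded Emax Emin) (hF : A.FeatureBounded Dmax) (hθ : A.θs ∈ A.Θ)
    (i j : Option (Fin d)) (x : EuclideanSpace ℝ (Fin m)) :
    |A.feat i x * A.feat j x * A.tilt A.θs x| ≤ boundConst Wmax Emax Dmax := by
  obtain ⟨-, b2, b3⟩ := le_boundConst Wmax Emax Dmax
  obtain ⟨-, h2, h3, -⟩ := hF _ hθ x
  rcases i with _ | t <;> rcases j with _ | s <;> simp only [feat_none, feat_some, mul_one, one_mul]
  · rw [abs_of_pos (A.tilt_pos (fun x => (hW.1 x).1) _ x)]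
    exact ((hR _ hθ).1 x).trans b2
  · exact (h2 s).trans b3
  · exact (h2 t).trans b3
  · exact (h3 t s).trans b3

lemma populationBounded {Wmax Wmin Emax Emin Dmax : ℝ} (hV : A.IsValid) (hWmin : 0 < Wmin)
    (hEmin : 0 < Emin) (hW : A.WeightBounded Wmax Wmin) (hR : A.RatioBounded Emax Emin)
    (hF : A.FeatureBounded Dmax) : A.PopulationBounded (boundConst Wmax Emax Dmax) Emin := by
  have := hV.prob_P
  have := hV.prob_Q
  have hθ : A.θs ∈ A.Θ := interior_subset hV.mem_interior
  refine ⟨boundConst_pos _ _ _, hEmin, hWmin.trans_le hW.2, fun i => ?_, fun i j => ?_, ?_⟩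
  · have h := norm_integral_le_of_norm_le_const (μ := A.P)
      (f := fun x => A.feat i x * A.w x)
      (ae_of_all _ fun x => abs_feat_mul_w_le (Emax := Emax) hW hF hθ i x)
    simpa [refMoment] using h
  · have h := norm_integral_le_of_norm_le_const (μ := A.Q)
      (f := fun x => A.feat i x * A.feat j x * A.tilt A.θs x)
      (ae_of_all _ fun x => abs_feat_mul_tilt_le hW hR hF hθ i j x)
    simpa [targetMoment] using h
  · rw [targetMoment_none]
    exact (hR _ hθ).2

/-- The slope error of the linearization of the contaminated gradient by the population Fisher
information. -/
lemma TiltBounded.abs_grad_sub_fisher_le {ι κ : Type*} [Fintype ι] [Fintype κ]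
    {xp : ι → EuclideanSpace ℝ (Fin m)} {xq : κ → EuclideanSpace ℝ (Fin m)}
    {r₀ E' B E ρ c cp cq ξ : ℝ} (T : A.TiltBounded r₀ E') (H : A.MomentsClose xp xq cp cq ξ)
    (hP : A.PopulationBounded B E) (hcp : 0 < cp) (hcq : 0 < cq) (hξ : ξ ≤ E / 2) (hξ1 : ξ ≤ 1)
    (hc : 0 < c) (hcE : 2 * c ≤ cq * (E / 2)) (hρ : ρ ≤ r₀ / 2)
    (hρc : momentConst r₀ E' * ρ ≤ c) (hW : ∀ x, A.w x ≤ B)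
    {θ₁ θ₂ : EuclideanSpace ℝ (Fin d)} (h₁ : ‖θ₁ - A.θs‖ ≤ ρ) (h₂ : ‖θ₂ - A.θs‖ ≤ ρ)
    (s₁ : ∀ t ∉ A.S, θ₁ t = 0) (s₂ : ∀ t ∉ A.S, θ₂ t = 0) (t : Fin d) :
    |A.grad xp xq θ₁ t - A.grad xp xq θ₂ t - ∑ s, (cp • A.fisher A.θs) t s * (θ₁ s - θ₂ s)|
      ≤ (B * ratioConst (momentConst r₀ E') c * ρ + cp * (hessConst B E * ξ) * √(A.k : ℝ))
        * ‖θ₁ - θ₂‖ := by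
  have h1 := T.grad_linearize xp xq h₁ h₂ hρ hc
    (hcE.trans (H.emp_tilt_ge hP hcq hξ)) hρc hW t
  have hξ0 : 0 ≤ ξ := (abs_nonneg _).trans (H.ref none)
  have hK := hessConst_pos hP.B_pos hP.E_pos
  have h2 : |∑ s, A.hess xp xq t s * (θ₁ s - θ₂ s)
      - ∑ s, (cp • A.fisher A.θs) t s * (θ₁ s - θ₂ s)|
      ≤ cp * (hessConst B E * ξ) * (√(A.k : ℝ) * ‖θ₁ - θ₂‖) := by
    have h3 := sum_abs_le_sqrt_card_mul_norm A.S (θ₁ - θ₂)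
    have h4 : ∑ s, |θ₁ s - θ₂ s| = ∑ s ∈ A.S, |(θ₁ - θ₂) s| :=
      (Finset.sum_subset (Finset.subset_univ _) fun u _ hu => by simp [s₁ u hu, s₂ u hu]).symm
    refine le_trans ?_ (mul_le_mul_of_nonneg_left h3 (by positivity))
    rw [← h4, ← Finset.sum_sub_distrib, Finset.mul_sum]
    refine (Finset.abs_sum_le_sum_abs _ _).trans (Finset.sum_le_sum fun s _ => ?_)
    rw [← sub_mul, abs_mul, Matrix.smul_apply, smul_eq_mul]
    gcongr
    exact H.abs_hess_sub_le hP hcp hcq hξ hξ1 t s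
  have e : A.grad xp xq θ₁ t - A.grad xp xq θ₂ t - ∑ s, (cp • A.fisher A.θs) t s * (θ₁ s - θ₂ s)
      = (A.grad xp xq θ₁ t - A.grad xp xq θ₂ t - ∑ s, A.hess xp xq t s * (θ₁ s - θ₂ s))
        + (∑ s, A.hess xp xq t s * (θ₁ s - θ₂ s)
          - ∑ s, (cp • A.fisher A.θs) t s * (θ₁ s - θ₂ s)) := by ring
  rw [e]
  refine (abs_add_le _ _).trans ((add_le_add h1 h2).trans_eq ?_)
  ring

/-- Bounds on the tuning parameter `lam`, the moment error `ξ` and the proportions of inliers under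
which the contaminated problem satisfies the hypotheses of the support recovery theorem with the
population Fisher information, scaled by the proportion `cp` of reference inliers. -/
lemma localModel {ι κ : Type*} [Fintype ι] [Fintype κ] [Nonempty κ]
    {xp : ι → EuclideanSpace ℝ (Fin m)} {xq : κ → EuclideanSpace ℝ (Fin m)}
    {r₀ E' B E ρ c cp cq ξ lmin α lam : ℝ} (T : A.TiltBounded r₀ E')
    (H : A.MomentsClose xp xq cp cq ξ) (hP : A.PopulationBounded B E) (hV : A.IsValid)
    (hS : A.S.Nonempty) (hl : 0 < lmin) (hα : 0 < α) (hα1 : α ≤ 1) (hD : A.Dependency lmin)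
    (hI : A.Incoherence α)
    (hcp : 0 < cp) (hcq : 0 < cq) (hξ : ξ ≤ E / 2) (hξ1 : ξ ≤ 1)
    (hc : 0 < c) (hcE : 2 * c ≤ cq * (E / 2)) (hρ : ρ ≤ r₀ / 2)
    (hρc : momentConst r₀ E' * ρ ≤ c) (hW : ∀ x, A.w x ≤ B) (hlam : 0 < lam)
    (hlamg : cp * (gradConst B E * ξ) ≤ α * lam / 8)
    (hρlam : ρ = 40 * √(A.k : ℝ) * lam / (cp * lmin))
    (hslope : 320 * √(A.k : ℝ) * (B * ratioConst (momentConst r₀ E') c * ρ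
      + cp * (hessConst B E * ξ) * √(A.k : ℝ)) ≤ α * (cp * lmin))
    (hbeta : ∀ t ∈ A.S, 2 * ρ ≤ |A.θs t|) :
    LocalModel (A.loss xp xq) (A.grad xp xq) A.θs A.S (cp • A.fisher A.θs) (cp * lmin) α lam
      (B * ratioConst (momentConst r₀ E') c * ρ + cp * (hessConst B E * ξ) * √(A.k : ℝ)) ρ where
  grad_le := A.loss_add_grad_le xp xq T.w_pos
  mem_S t := by simp [S]
  nonempty_S := hS
  κ_pos := by positivity
  α_pos := hα
  α_le := hα1
  lam_pos := hlam
  ρ_eq := hρlam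
  slope_le := hslope
  curvature v hv := by
    have h1 := mul_le_mul_of_nonneg_left (A.fisher_curvature hD v hv) hcp.le
    rw [Finset.mul_sum] at h1
    calc cp * lmin * ‖v‖ ^ 2 = cp * (lmin * ‖v‖ ^ 2) := by ring
      _ ≤ _ := h1
      _ = _ := Finset.sum_congr rfl fun t _ => by
        simp only [Matrix.smul_apply, smul_eq_mul, mul_assoc, ← Finset.mul_sum]
  incoherence v hv b hb t ht := by
    have e : ∀ u, ∑ s, (cp • A.fisher A.θs) u s * v s = cp * ∑ s, A.fisher A.θs u s * v s :=
      fun u => by simp only [Matrix.smul_apply, smul_eq_mul, mul_assoc, ← Finset.mul_sum]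
    simp only [e, abs_mul, abs_of_pos hcp] at hb ⊢
    have h1 := A.fisher_incoherence hl hD hI v hv (b / cp)
      (fun u hu => by rw [le_div_iff₀ hcp, mul_comm]; exact hb u hu) t ht hS
    calc _ ≤ cp * ((1 - α) * (b / cp)) := by gcongr
      _ = _ := by field_simp
  grad_small t := (H.abs_grad_le hP hV hcp hcq hξ hξ1 t).trans hlamg
  linearize θ₁ θ₂ h₁ h₂ s₁ s₂ t :=
    T.abs_grad_sub_fisher_le H hP hcp hcq hξ hξ1 hc hcE hρ hρc hW h₁ h₂ s₁ s₂ t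
  beta_min := hbeta

end Model

/-! ### Choice of the constants -/

/-- Multiple of the statistical error `√(log (6 d / δ) / n)` in the tuning parameter. -/
def statConst (B E α : ℝ) : ℝ := 16 * B * gradConst B E / α

/-- Multiple of the contamination `ε ν` in the tuning parameter; `γ` is a lower bound for the
proportions of inliers. -/
def outlierConst (B E α γ : ℝ) : ℝ := 8 * gradConst B E / (α * γ)

/-- Factor between the moment error and the sum of statistical error and contamination. -/
def errorConst (B γ : ℝ) : ℝ := 2 * B + 1 / γ

/-- Factor between the radius of the neighbourhood of `θs` and `√k` times the sum of statistical
error and contamination. -/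
def radiusConst (B E α γ lmin : ℝ) : ℝ :=
  40 * (statConst B E α + 1 + outlierConst B E α γ) / (γ * lmin)

lemma statConst_pos {B E α : ℝ} (hB : 0 < B) (hE : 0 < E) (hα : 0 < α) : 0 < statConst B E α := by
  have := gradConst_pos hB hE
  unfold statConst; positivity

lemma outlierConst_pos {B E α γ : ℝ} (hB : 0 < B) (hE : 0 < E) (hα : 0 < α) (hγ : 0 < γ) :
    0 < outlierConst B E α γ := by
  have := gradConst_pos hB hE
  unfold outlierConst; positivity

lemma radiusConst_pos {B E α γ lmin : ℝ} (hB : 0 < B) (hE : 0 < E) (hα : 0 < α) (hγ : 0 < γ)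
    (hl : 0 < lmin) : 0 < radiusConst B E α γ lmin := by
  have := statConst_pos hB hE hα
  have := outlierConst_pos hB hE hα hγ
  unfold radiusConst; positivity

/-- `τ` bounds `k` times the sum of statistical error and contamination tightly enough for the
support recovery argument. -/
structure SmallEnough (B E α γ lmin r₀ τ : ℝ) : Prop where
  pos : 0 < τ
  error_le_one : τ * errorConst B γ ≤ 1
  error_le_half : τ * errorConst B γ ≤ E / 2
  radius_le : τ * radiusConst B E α γ lmin ≤ r₀ / 2
  moment_le : τ * (Model.momentConst r₀ B * radiusConst B E α γ lmin) ≤ γ * E / 4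
  hess_le : τ * (640 * hessConst B E * errorConst B γ) ≤ α * lmin
  curvature_le : τ * (640 * (B * ratioConst (Model.momentConst r₀ B) (γ * E / 4))
    * radiusConst B E α γ lmin) ≤ α * γ * lmin

lemma exists_smallEnough (B : ℝ) {E α γ lmin r₀ : ℝ} (hE : 0 < E) (hα : 0 < α)
    (hγ : 0 < γ) (hl : 0 < lmin) (hr : 0 < r₀) : ∃ τ, SmallEnough B E α γ lmin r₀ τ := by
  have h := (((((eventually_mul_le (errorConst B γ) one_pos).and
    (eventually_mul_le (errorConst B γ) (half_pos hE))).and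
    (eventually_mul_le (radiusConst B E α γ lmin) (half_pos hr))).and
    (eventually_mul_le (Model.momentConst r₀ B * radiusConst B E α γ lmin)
      (by positivity : 0 < γ * E / 4))).and
    (eventually_mul_le (640 * hessConst B E * errorConst B γ) (mul_pos hα hl))).and
    ((eventually_mul_le (640 * (B * ratioConst (Model.momentConst r₀ B) (γ * E / 4))
      * radiusConst B E α γ lmin) (by positivity : 0 < α * γ * lmin)).and self_mem_nhdsWithin)
  obtain ⟨τ, ⟨⟨⟨⟨h1, h2⟩, h3⟩, h4⟩, h5⟩, h6, h7⟩ := h.exists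
  exact ⟨τ, h7, h1, h2, h3, h4, h5, h6⟩

/-- The numerical conditions of the support recovery theorem. Here `r` and `r'` are the two
statistical errors, `e` the contamination and `k` the size of the support. -/
lemma SmallEnough.conditions {B E α γ lmin r₀ τ : ℝ} (T : SmallEnough B E α γ lmin r₀ τ)
    (hB : 0 < B) (hE : 0 < E) (hα : 0 < α) (hγ : 0 < γ) (hl : 0 < lmin) (hr₀ : 0 < r₀)
    {r r' e cp lam ρ k : ℝ} (hr : 0 < r) (hr' : 0 ≤ r') (hrr : r' ≤ r) (he : 0 ≤ e)
    (hcp : γ ≤ cp) (hcp1 : cp ≤ 1) (hk : 1 ≤ k) (hsmall : k * (r + e) ≤ τ)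
    (hlam : lam = statConst B E α * cp * r + 1 * cp * r' + outlierConst B E α γ * e)
    (hρ : ρ = 40 * √k * lam / (cp * lmin)) :
    2 * B * r + e / γ ≤ E / 2 ∧ 2 * B * r + e / γ ≤ 1 ∧ ρ ≤ r₀ / 2 ∧
    Model.momentConst r₀ B * ρ ≤ γ * E / 4 ∧ 0 < lam ∧
    cp * (gradConst B E * (2 * B * r + e / γ)) ≤ α * lam / 8 ∧
    320 * √k * (B * ratioConst (Model.momentConst r₀ B) (γ * E / 4) * ρ
      + cp * (hessConst B E * (2 * B * r + e / γ)) * √k) ≤ α * (cp * lmin) := by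
  have hcp0 : 0 < cp := hγ.trans_le hcp
  have hL := statConst_pos hB hE hα
  have hN := outlierConst_pos hB hE hα hγ
  have hY := radiusConst_pos hB hE hα hγ hl
  have hK1 := gradConst_pos hB hE
  have hK2 := hessConst_pos hB hE
  have hK0 : 0 < Model.momentConst r₀ B := by unfold Model.momentConst; positivity
  have hR : 0 < ratioConst (Model.momentConst r₀ B) (γ * E / 4) := by unfold ratioConst; positivity
  have hX : 0 < errorConst B γ := by unfold errorConst; positivity
  set u := r + e with hu
  have hu0 : 0 < u := by positivity
  have hsq1 : 1 ≤ √k := Real.one_le_sqrt.2 hk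
  have hsqk : √k * √k = k := Real.mul_self_sqrt (by linarith)
  have huτ : u ≤ τ := by nlinarith
  have hξ : 2 * B * r + e / γ ≤ errorConst B γ * u := by
    have h1 : errorConst B γ * u - (2 * B * r + e / γ) = 2 * B * e + r / γ := by
      unfold errorConst; rw [hu]; ring
    have h2 : 0 ≤ 2 * B * e + r / γ := by positivity
    linarith
  have hξτ : 2 * B * r + e / γ ≤ τ * errorConst B γ := by
    rw [mul_comm τ]
    exact hξ.trans (by gcongr)
  have hlam0 : 0 < lam := by rw [hlam]; positivity
  have hlamu : lam ≤ (statConst B E α + 1 + outlierConst B E α γ) * u := by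
    have h1 : statConst B E α * cp * r ≤ statConst B E α * 1 * r := by gcongr
    have h2 : 1 * cp * r' ≤ 1 * 1 * r := by gcongr
    have h3 : (statConst B E α + 1 + outlierConst B E α γ) * u
      = statConst B E α * 1 * r + 1 * 1 * r + outlierConst B E α γ * e
        + ((statConst B E α + 1) * e + outlierConst B E α γ * r) := by rw [hu]; ring
    have h4 : 0 ≤ (statConst B E α + 1) * e + outlierConst B E α γ * r := by positivity
    linarith
  have hρY : ρ ≤ radiusConst B E α γ lmin * (√k * u) := by
    calc ρ ≤ 40 * √k * ((statConst B E α + 1 + outlierConst B E α γ) * u) / (γ * lmin) := by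
          rw [hρ]; gcongr
      _ = _ := by unfold radiusConst; ring
  have hku : √k * (√k * u) ≤ τ := by rw [← mul_assoc, hsqk]; exact hsmall
  have hsu : √k * u ≤ τ := by
    refine le_trans ?_ hku
    exact le_mul_of_one_le_left (by positivity) hsq1
  have hρτ : ρ ≤ τ * radiusConst B E α γ lmin := by
    rw [mul_comm τ]
    exact hρY.trans (by gcongr)
  refine ⟨hξτ.trans T.error_le_half, hξτ.trans T.error_le_one, hρτ.trans T.radius_le, ?_, hlam0,
    ?_, ?_⟩
  · refine le_trans ?_ T.moment_le
    calc Model.momentConst r₀ B * ρ ≤ Model.momentConst r₀ B * (τ * radiusConst B E α γ lmin) := by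
          gcongr
      _ = _ := by ring
  · have h1 : α * lam / 8 = 2 * B * gradConst B E * cp * r + α * cp * r' / 8
        + gradConst B E * e / γ := by
      rw [hlam]
      unfold statConst outlierConst
      field_simp
      ring
    have h2 : cp * (gradConst B E * (2 * B * r + e / γ))
        = 2 * B * gradConst B E * cp * r + cp * (gradConst B E * e / γ) := by ring
    have h3 : cp * (gradConst B E * e / γ) ≤ 1 * (gradConst B E * e / γ) := by gcongr
    have h4 : 0 ≤ α * cp * r' / 8 := by positivity
    linarith
  · have h1 : 320 * (B * ratioConst (Model.momentConst r₀ B) (γ * E / 4)) * (√k * ρ)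
        ≤ α * (cp * lmin) / 2 := by
      have h2 : √k * ρ ≤ τ * radiusConst B E α γ lmin := by
        calc √k * ρ ≤ √k * (radiusConst B E α γ lmin * (√k * u)) := by gcongr
          _ = (√k * (√k * u)) * radiusConst B E α γ lmin := by ring
          _ ≤ _ := by gcongr
      have h3 := T.curvature_le
      have h4 : α * γ * lmin ≤ α * (cp * lmin) := by rw [mul_assoc]; gcongr
      calc _ ≤ 320 * (B * ratioConst (Model.momentConst r₀ B) (γ * E / 4))
            * (τ * radiusConst B E α γ lmin) := by gcongr
        _ = τ * (640 * (B * ratioConst (Model.momentConst r₀ B) (γ * E / 4))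
            * radiusConst B E α γ lmin) / 2 := by ring
        _ ≤ _ := by linarith
    have h5 : 320 * (cp * (hessConst B E * (2 * B * r + e / γ))) * k ≤ α * (cp * lmin) / 2 := by
      have h6 : (2 * B * r + e / γ) * k ≤ errorConst B γ * τ := by
        calc _ ≤ errorConst B γ * u * k := by gcongr
          _ = errorConst B γ * (k * u) := by ring
          _ ≤ _ := by gcongr
      calc _ = 320 * cp * hessConst B E * ((2 * B * r + e / γ) * k) := by ring
        _ ≤ 320 * cp * hessConst B E * (errorConst B γ * τ) := by gcongr
        _ = cp * (τ * (640 * hessConst B E * errorConst B γ)) / 2 := by ring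
        _ ≤ cp * (α * lmin) / 2 := by
          have := mul_le_mul_of_nonneg_left T.hess_le hcp0.le
          linarith
        _ = _ := by ring
    calc _ = 320 * (B * ratioConst (Model.momentConst r₀ B) (γ * E / 4)) * (√k * ρ)
          + 320 * (cp * (hessConst B E * (2 * B * r + e / γ))) * (√k * √k) := by ring
      _ ≤ _ := by rw [hsqk]; linarith

end WDRE

end

theorem theorem2 :
    ∀ (Wmax Wmin Emax Emin Dmax α : ℝ), 0 < Wmin → 0 < Emin → 0 < α → α ≤ 1 →
    ∃ L > (0 : ℝ), ∃ M > (0 : ℝ),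
    ∀ εbar : ℝ, εbar < 1 → ∃ N > (0 : ℝ),
    ∀ (lmin l3max r₀ δ : ℝ), 0 < lmin → 0 < r₀ → 0 < δ → δ < 1 →
    ∃ C > (0 : ℝ), ∃ c > (0 : ℝ),
    ∀ (m d : ℕ) (A : WDRE.Model m d), 2 ≤ d → A.S.Nonempty → A.IsValid →
      Metric.closedBall A.θs r₀ ⊆ A.Θ →
      A.WeightBounded Wmax Wmin → A.RatioBounded Emax Emin → A.FeatureBounded Dmax →
      A.Dependency lmin → A.Incoherence α → A.Smoothness l3max →
    ∀ (np nq op oq : ℕ),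
      WDRE.contam np op ≤ εbar → WDRE.contam nq oq ≤ εbar →
      C * (A.k : ℝ) ^ 3 * Real.log d ≤ ((min np nq : ℕ) : ℝ) →
    ∀ (Ω : Type*) [MeasurableSpace Ω] (μ : Measure Ω) [IsProbabilityMeasure μ]
      (Xp : Fin np → Ω → EuclideanSpace ℝ (Fin m)) (Xq : Fin nq → Ω → EuclideanSpace ℝ (Fin m))
      (Zp : Fin op → Ω → EuclideanSpace ℝ (Fin m)) (Zq : Fin oq → Ω → EuclideanSpace ℝ (Fin m)),
      (∀ i, Measurable (Xp i)) → (∀ i, μ.map (Xp i) = A.P) → iIndepFun Xp μ →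
      (∀ i, Measurable (Xq i)) → (∀ i, μ.map (Xq i) = A.Q) → iIndepFun Xq μ →
    ∃ G : Set Ω, MeasurableSet G ∧ ENNReal.ofReal (1 - 8 * δ) ≤ μ G ∧
      ∀ ω ∈ G, ∀ εp ε ν npq : ℝ,
        εp = WDRE.contam np op → ε = max (WDRE.contam np op) (WDRE.contam nq oq) →
        ν = A.ν (fun i => Zp i ω) (fun i => Zq i ω) → npq = ((min np nq : ℕ) : ℝ) →
        (A.k : ℝ) ^ (3 / 2 : ℝ) * ε * ν ≤ c →
        (∀ t ∈ A.S, WDRE.rate 80 L M N lmin δ εp ε ν npq np A.k d ≤ |A.θs t|) →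
        ∃ θhat : EuclideanSpace ℝ (Fin d),
          (∀ θ, A.IsEstimator (WDRE.regParam L M N δ εp ε ν npq np d)
              (WDRE.merge (fun i => Xp i ω) (fun i => Zp i ω))
              (WDRE.merge (fun i => Xq i ω) (fun i => Zq i ω)) θ ↔ θ = θhat) ∧
          (∀ t ∈ A.S, θhat t ≠ 0) ∧ (∀ t ∉ A.S, θhat t = 0) ∧
          ‖θhat - A.θs‖ ≤ WDRE.rate 40 L M N lmin δ εp ε ν npq np A.k d := by
  intro Wmax Wmin Emax Emin Dmax α hWmin hEmin hα hα1
  have hB := WDRE.boundConst_pos Wmax Emax Dmax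
  obtain ⟨hBW, hBE, -⟩ := WDRE.le_boundConst Wmax Emax Dmax
  set B := WDRE.boundConst Wmax Emax Dmax with hBdef
  -- the first term of the tuning parameter already dominates the deviation of the mean weight, so
  -- the coefficient of the second may be any positive number
  refine ⟨WDRE.statConst B Emin α, WDRE.statConst_pos hB hEmin hα, 1, one_pos, ?_⟩
  intro εbar hεbar
  have hγ : 0 < 1 - εbar := by linarith
  refine ⟨WDRE.outlierConst B Emin α (1 - εbar), WDRE.outlierConst_pos hB hEmin hα hγ, ?_⟩
  intro lmin l3max r₀ δ hl hr₀ hδ hδ1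
  obtain ⟨τ, hτ⟩ := WDRE.exists_smallEnough B hEmin hα hγ hl hr₀
  have hτ0 := hτ.pos
  have hlogC := WDRE.logConst_pos hδ hδ1
  refine ⟨4 * WDRE.logConst δ / τ ^ 2, by positivity, τ / 2, by positivity, ?_⟩
  intro m d A hd hS hV hball hW hR hF hD hI _ np nq op oq hcp hcq hn Ω _ μ _ Xp Xq Zp Zq
    mp lp ip mq lq iq
  have hk : 1 ≤ A.k := hS.card_pos
  have hk' : (1 : ℝ) ≤ A.k := by exact_mod_cast hk
  have hlogd : 0 < Real.log d := Real.log_pos (by exact_mod_cast hd)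
  have hd' : (2 : ℝ) ≤ d := by exact_mod_cast hd
  have hmin' : (0 : ℝ) < ((min np nq : ℕ) : ℝ) := lt_of_lt_of_le (by positivity) hn
  have hmin : 0 < min np nq := by exact_mod_cast hmin'
  have hnp : 0 < np := hmin.trans_le (min_le_left _ _)
  have hnq : 0 < nq := hmin.trans_le (min_le_right _ _)
  have hw : ∀ x, 0 < A.w x := fun x => (hW.1 x).1
  have hθ : A.θs ∈ A.Θ := interior_subset hV.mem_interior
  obtain ⟨G, hGm, hGμ, hG⟩ := A.exists_concentration_event hV hd hB hδ hδ1
    (fun i x => WDRE.Model.abs_feat_mul_w_le hW hF hθ i x)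
    (fun i j x => WDRE.Model.abs_feat_mul_tilt_le hW hR hF hθ i j x) hnp hnq μ Xp Xq
    mp lp ip mq lq iq
  refine ⟨G, hGm, hGμ, ?_⟩
  rintro ω hω εp ε ν npq rfl rfl hν rfl hc hbeta
  have hν0 : 0 ≤ ν := hν ▸ A.ν_nonneg _ _ hw
  set cp := 1 - WDRE.contam np op with hcpdef
  have hcpγ : 1 - εbar ≤ cp := by rw [hcpdef]; linarith
  have hcp0 : 0 < cp := hγ.trans_le hcpγ
  have hcp1 : cp ≤ 1 := by have := WDRE.contam_nonneg np op; rw [hcpdef]; linarith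
  have hcqγ : 1 - εbar ≤ 1 - WDRE.contam nq oq := by linarith
  set ε := max (WDRE.contam np op) (WDRE.contam nq oq) with hεdef
  have hε0 : 0 ≤ ε := (WDRE.contam_nonneg _ _).trans (le_max_left _ _)
  have hclose := (hG ω hω).momentsClose hnp hnq (zp := fun i => Zp i ω) (zq := fun i => Zq i ω)
    hcp hcq hεbar hν0
    (fun i n => hν ▸ A.abs_ref_outlier_le (fun i => Zp i ω) (fun i => Zq i ω) hw i n)
    (fun i j n => hν ▸ A.abs_target_outlier_le
      (fun i => Zp i ω) (fun i => Zq i ω) hw hR hF hθ i j n)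
  rw [← hεdef, ← hcpdef] at hclose
  have hT : A.TiltBounded r₀ B :=
    ⟨hr₀, hw, fun θ hθ' x => ((hR θ (hball hθ')).1 x).trans hBE⟩
  have hP : A.PopulationBounded B Emin := WDRE.Model.populationBounded hV hWmin hEmin hW hR hF
  -- the statistical errors and the contamination are small compared to `1 / k`
  have hl6 : 0 < Real.log (6 * d / δ) := Real.log_pos (by rw [lt_div_iff₀ hδ]; linarith)
  have hr : 0 < √(Real.log (6 * d / δ) / ((min np nq : ℕ) : ℝ)) := by positivity
  have hrr : √(Real.log (2 / δ) / np) ≤ √(Real.log (6 * d / δ) / ((min np nq : ℕ) : ℝ)) := by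
    have h1 : ((min np nq : ℕ) : ℝ) ≤ np := by exact_mod_cast min_le_left np nq
    have h2 : Real.log (2 / δ) ≤ Real.log (6 * d / δ) :=
      Real.log_le_log (by positivity) (by gcongr; linarith)
    exact Real.sqrt_le_sqrt (div_le_div₀ hl6.le h2 hmin' h1)
  have he : 0 ≤ ε * ν := mul_nonneg hε0 hν0
  have hke : (A.k : ℝ) * (ε * ν) ≤ τ / 2 := by
    refine le_trans ?_ hc
    rw [mul_assoc]
    gcongr
    calc (A.k : ℝ) = (A.k : ℝ) ^ (1 : ℝ) := (Real.rpow_one _).symm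
      _ ≤ (A.k : ℝ) ^ (3 / 2 : ℝ) := Real.rpow_le_rpow_of_exponent_le hk' (by norm_num)
  have hkr := WDRE.card_mul_sqrt_le hδ hδ1 hτ0 hd hk hn
  have hreg : WDRE.regParam (WDRE.statConst B Emin α) 1 (WDRE.outlierConst B Emin α (1 - εbar)) δ
      (WDRE.contam np op) ε ν ((min np nq : ℕ) : ℝ) np d
      = WDRE.statConst B Emin α * cp * √(Real.log (6 * d / δ) / ((min np nq : ℕ) : ℝ))
        + 1 * cp * √(Real.log (2 / δ) / np)
        + WDRE.outlierConst B Emin α (1 - εbar) * (ε * ν) := rfl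
  simp only [WDRE.rate_eq _ _ _ _ _ _ _ _ _ _ _ _ _ hl.ne' hcp0.ne'] at hbeta ⊢
  rw [← hcpdef] at hbeta ⊢
  set lam := WDRE.regParam (WDRE.statConst B Emin α) 1 (WDRE.outlierConst B Emin α (1 - εbar)) δ
      (WDRE.contam np op) ε ν ((min np nq : ℕ) : ℝ) np d with hlamdef
  obtain ⟨c1, c2, c3, c4, c5, c6, c7⟩ := hτ.conditions hB hEmin hα hγ hl hr₀ hr
    (Real.sqrt_nonneg _) hrr he hcpγ hcp1 hk' (by linarith) hreg rfl
  have : Nonempty (Fin nq ⊕ Fin oq) := ⟨Sum.inl ⟨0, hnq⟩⟩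
  have hmodel := WDRE.Model.localModel hT hclose hP hV hS hl hα hα1 hD hI hcp0
    (hγ.trans_le hcqγ) c1 c2 (by positivity : 0 < (1 - εbar) * Emin / 4)
    (by nlinarith) c3 c4 (fun x => (hW.1 x).2.trans hBW) c5 c6 rfl c7
    (fun t ht => le_trans (by ring_nf; rfl) (hbeta t ht))
  exact hmodel.support_recovery hV.isCompact_Θ (A.continuous_loss _ _ hw) hball (by linarith)
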